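/- Let $A$ be a set of actions with a distinguished termination action $\surd\in A$, let $\lambda\in(0,1]$, and let $T$ be the set of closed terms (processes) built from the constants $0$ and $\varepsilon$, the probabilistic prefixes $a.([p_1]\_\oplus\dots\oplus[p_m]\_)$ ($a\in A$, $m\ge 1$, $p_k\in(0,1]$, $\sum_k p_k=1$) and the binary operators $;$ (sequential composition), $+$, $+_p$ (nondeterministic and probabilistic alternative composition), $\mid$ (synchronous parallel composition), $|||$, $|||_p$ (nondeterministic and probabilistic interleaving), with $p\in(0,1)$, and $\parallel_B$ with $B\subseteq A$ (CSP parallel composition). Write $t\xrightarrow{a}\pi$, with $\pi$ a probability distribution on $T$, for the transitions derived from the following rules, where $\delta(t)$ is the Dirac distribution, $\mu\oplus_p\nu=p\mu+(1-p)\nu$, and operators are applied to distributions via the product distribution. * $\varepsilon\xrightarrow{\surd}\delta(0)$; $\;a.([p_1]t_1\oplus\dots\oplus[p_m]t_m)\xrightarrow{a}\sum_k p_k\delta(t_k)$; $0$ has no transition. * $x;y\xrightarrow{a}\mu;\delta(y)$ if $x\xrightarrow{a}\mu$, $a\ne\surd$; $\;x;y\xrightarrow{a}\nu$ if $x$ has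 a $\surd$-transition and $y\xrightarrow{a}\nu$. * $x+y\xrightarrow{a}\mu$ if $x\xrightarrow{a}\mu$ or $y\xrightarrow{a}\mu$. * $x+_py\xrightarrow{a}\mu\oplus_p\nu$ if $x\xrightarrow{a}\mu$ and $y\xrightarrow{a}\nu$; if only one of $x,y$ has an $a$-transition, then $x+_py$ has its $a$-transitions. * For $f$ any of $\mid,|||,|||_p,\parallel_B$: $x\,f\,y\xrightarrow{\surd}\delta(0)$ if both $x$ and $y$ have a $\surd$-transition, and no other $\surd$-transition exists. For $a\neq\surd$: $\mid$ has the transitions $x\mid y\xrightarrow{a}\mu\mid\nu$ with $x\xrightarrow{a}\mu$, $y\xrightarrow{a}\nu$; $|||$ has the transitions $x\,|||\,y\xrightarrow{a}\mu\,|||\,\delta(y)$ with $x\xrightarrow{a}\mu$ and $x\,|||\,y\xrightarrow{a}\delta(x)\,|||\,\nu$ with $y\xrightarrow{a}\nu$; $\parallel_B$ behaves like $\mid$ for $a\in B$ and like $|||$ for $a\notin B$; $x\,|||_p\,y\xrightarrow{a}(\mu\,|||_p\,\delta(y))\oplus_p(\delta(x)\,|||_p\,\nu)$ if $x\xrightarrow{a}\mu$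 and $y\xrightarrow{a}\nu$, and if only one of $x,y$ has an $a$-transition, then $|||_p$ behaves like $|||$. Let $\mathbf d$ be the $\lambda$-bisimilarity metric on $T$, i.e. the smallest pseudometric $d\colon T\times T\to[0,1]$ such that whenever $d(t,t')<1$ and $t\xrightarrow{a}\pi$ there is $t'\xrightarrow{a}\pi'$ with $\lambda\,\mathbf K(d)(\pi,\pi')\le d(t,t')$, where $\mathbf K(d)$ is the Kantorovich lifting of $d$ (minimal expected $d$-distance over all couplings). A binary operator $f$ is non-extensive if $\mathbf d(f(s_1,s_2),f(t_1,t_2))\le\max(\mathbf d(s_1,t_1),\mathbf d(s_2,t_2))$ for all processes. Let $N\ge2$ and suppose that $A$ contains at least $N+2$ actions other than $\surd$. Then for all $\epsilon_1,\dots,\epsilon_N\in[0,\lambda]\cup\{1\}$ (so for all $\epsilon_i\in[0,1]$ if $\lambda=1$) and every $B\subseteq A$ there are processes $s_i,t_i\in T$ with $\mathbf d(s_i,t_i)=\epsilon_i$ ($1\le i\le N$) such that, with $$d^n_{i,j}=\epsilon_i+\lambda^n(1-\epsilon_i/\lambda)\epsilon_j,\quad d^s=\begin{cases}1&\text{if }\epsilon_1=1\text{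 or }\epsilon_2=1\\ d^0_{1,2}&\text{otherwise,}\end{cases}\quad d^a=\begin{cases}1&\text{if }\epsilon_1=1\text{ or }\epsilon_2=1\\ \max(d^2_{1,2},d^2_{2,1})&\text{otherwise,}\end{cases}$$ all of the following hold simultaneously: 1. $\mathbf d(a.\bigoplus_{k=1}^m[p_k]s_{i_k},\,a.\bigoplus_{k=1}^m[p_k]t_{i_k})=\lambda\sum_{k=1}^m p_k\epsilon_{i_k}$ for every $a\in A$, all weights $p_1,\dots,p_m\in(0,1]$ of sum $1$ and all indices $i_1,\dots,i_m\in\{1,\dots,N\}$; 2. $\mathbf d(s_1+s_2,t_1+t_2)=\max(\epsilon_1,\epsilon_2)$, and $\mathbf d(s_1+_ps_2,t_1+_pt_2)=\max(\epsilon_1,\epsilon_2)$ for every $p\in(0,1)$; 3. $\mathbf d(s_1;s_2,t_1;t_2)$ is $1$ if $\epsilon_1=1$, and $\max(d^1_{1,2},\epsilon_2)$ otherwise; 4. $\mathbf d(s_1\mid s_2,t_1\mid t_2)=d^s$; 5. $\mathbf d(s_1\,|||\,s_2,t_1\,|||\,t_2)=d^a$, and $\mathbf d(s_1\,|||_p\,s_2,t_1\,|||_p\,t_2)=d^a$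 for every $p\in(0,1)$; 6. $\mathbf d(s_1\parallel_Bs_2,t_1\parallel_Bt_2)$ is $d^s$ if $B\setminus\{\surd\}\ne\emptyset$, and $d^a$ otherwise. Moreover, none of $;$, $\mid$, $|||$, $\parallel_B$ ($B\subseteq A$), $|||_p$ ($p\in(0,1)$) is non-extensive with respect to $\mathbf d$. -/

import Mathlib

open scoped ENNReal

noncomputable section

/-! ### Probability distributions -/

/-- The convex combination `μ ⊕_p ν`, i.e. `p μ + (1 - p) ν`. -/
def convexComb {S : Type*} (p : Set.Ioo (0 : ℝ) 1) (μ ν : PMF S) : PMF S :=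
  ⟨fun x => ENNReal.ofReal p * μ x + ENNReal.ofReal (1 - p) * ν x, by
    have h : ENNReal.ofReal p * 1 + ENNReal.ofReal (1 - p) * 1 = 1 := by
      rw [mul_one, mul_one, ← ENNReal.ofReal_add p.2.1.le (by linarith [p.2.2])]
      simp
    have h1 : HasSum (fun x => ENNReal.ofReal p * μ x + ENNReal.ofReal (1 - p) * ν x)
        (∑' x, (ENNReal.ofReal p * μ x + ENNReal.ofReal (1 - p) * ν x)) :=
      ENNReal.summable.hasSum
    rwa [ENNReal.tsum_add, ENNReal.tsum_mul_left, ENNReal.tsum_mul_left, PMF.tsum_coe,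
      PMF.tsum_coe, h] at h1⟩

/-- The product distribution `f(μ, ν)` for a binary operator `f`: the distribution of `f x y`
for independent `x` and `y` distributed according to `μ` and `ν`. -/
def liftOp {S : Type*} (f : S → S → S) (μ ν : PMF S) : PMF S :=
  μ.bind fun x => ν.map fun y => f x y

/-- Weights `p₁, …, pₙ > 0` with `p₁ + ⋯ + pₙ = 1` (so `n ≥ 1` and every `pᵢ` is in `(0, 1]`). -/
structure Weights (n : ℕ) where
  w : Fin n → ℝ
  pos : ∀ i, 0 < w i
  sum_eq_one : ∑ i, w i = 1

/-- The distribution on indices that gives `i` the probability `pᵢ`. -/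
def Weights.toPMF {n : ℕ} (p : Weights n) : PMF (Fin n) :=
  PMF.ofFintype (fun i => ENNReal.ofReal (p.w i)) (by
    rw [← ENNReal.ofReal_sum_of_nonneg fun i _ => (p.pos i).le, p.sum_eq_one,
      ENNReal.ofReal_one])

/-! ### Bisimilarity metric of a probabilistic transition system -/

/-- A `1`-bounded pseudometric on `S`. -/
structure IsBoundedPseudometric {S : Type*} (d : S → S → ℝ) : Prop where
  nonneg : ∀ x y, 0 ≤ d x y
  le_one : ∀ x y, d x y ≤ 1
  self : ∀ x, d x x = 0
  symm : ∀ x y, d x y = d y x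
  triangle : ∀ x y z, d x z ≤ d x y + d y z

/-- The matchings of two distributions: the distributions on the product with the given
marginals. -/
def matchings {S : Type*} (π π' : PMF S) : Set (PMF (S × S)) :=
  {ω | ω.map Prod.fst = π ∧ ω.map Prod.snd = π'}

/-- The Kantorovich lifting of `d`. -/
def kantorovich {S : Type*} (d : S → S → ℝ) (π π' : PMF S) : ℝ :=
  sInf ((fun ω : PMF (S × S) => ∑' x : S × S, d x.1 x.2 * (ω x).toReal) '' matchings π π')

/-- `d` is a `lam`-bisimulation metric for the probabilistic transition system with transition
relation `tr`. -/
structure IsBisimMetric {S A : Type*} (tr : S → A → PMF S → Prop) (lam : ℝ)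
    (d : S → S → ℝ) : Prop where
  isBoundedPseudometric : IsBoundedPseudometric d
  transfer : ∀ s t, d s t < 1 → ∀ a π, tr s a π →
    ∃ π', tr t a π' ∧ lam * kantorovich d π π' ≤ d s t

/-- The `lam`-bisimilarity metric: the smallest `lam`-bisimulation metric, i.e. the pointwise
infimum of all of them. -/
def bisimDist {S A : Type*} (tr : S → A → PMF S → Prop) (lam : ℝ) (s t : S) : ℝ :=
  sInf {r | ∃ d, IsBisimMetric tr lam d ∧ r = d s t}

/-! ### The process algebra -/

/-- Closed terms of the process algebra over the action set `A`. -/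
inductive Proc (A : Type*) where
  /-- the inactive process `0` -/
  | nil : Proc A
  /-- the skip process `ε` -/
  | skip : Proc A
  /-- the probabilistic prefix `a.([p₁]t₁ ⊕ ⋯ ⊕ [pₙ]tₙ)` -/
  | pre (a : A) {n : ℕ} (p : Weights n) (t : Fin n → Proc A) : Proc A
  /-- sequential composition `s ; t` -/
  | seq (s t : Proc A) : Proc A
  /-- alternative composition `s + t` -/
  | alt (s t : Proc A) : Proc A
  /-- probabilistic alternative composition `s +_p t` -/
  | palt (p : Set.Ioo (0 : ℝ) 1) (s t : Proc A) : Proc A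
  /-- synchronous parallel composition `s | t` -/
  | sync (s t : Proc A) : Proc A
  /-- asynchronous parallel composition `s ||| t` -/
  | async (s t : Proc A) : Proc A
  /-- probabilistic parallel composition `s |||_p t` -/
  | pasync (p : Set.Ioo (0 : ℝ) 1) (s t : Proc A) : Proc A
  /-- CSP-like parallel composition `s ∥_B t` -/
  | csp (B : Set A) (s t : Proc A) : Proc A

/-- The transition relation: `Step tick t a π` means `t —a→ π`, where `tick` is the successful
termination action. Each disjunct is one SOS rule; since premises only concern the arguments of
the source, the transitions are determined by recursion on the source term. -/
def Step {A : Type*} (tick : A) : Proc A → A → PMF (Proc A) → Prop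
  | .nil, _, _ => False
  | .skip, a, π => a = tick ∧ π = PMF.pure .nil
  | .pre b p t, a, π => a = b ∧ π = p.toPMF.map t
  | .seq x y, a, π =>
      (a ≠ tick ∧ ∃ μ, Step tick x a μ ∧ π = liftOp .seq μ (PMF.pure y)) ∨
      ((∃ μ, Step tick x tick μ) ∧ Step tick y a π)
  | .alt x y, a, π => Step tick x a π ∨ Step tick y a π
  | .palt p x y, a, π =>
      (Step tick x a π ∧ ¬ ∃ ν, Step tick y a ν) ∨
      ((¬ ∃ μ, Step tick x a μ) ∧ Step tick y a π) ∨
      (∃ μ ν, Step tick x a μ ∧ Step tick y a ν ∧ π = convexComb p μ ν)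
  | .sync x y, a, π =>
      (a ≠ tick ∧ ∃ μ ν, Step tick x a μ ∧ Step tick y a ν ∧ π = liftOp .sync μ ν) ∨
      (a = tick ∧ (∃ μ, Step tick x tick μ) ∧ (∃ ν, Step tick y tick ν) ∧
        π = PMF.pure .nil)
  | .async x y, a, π =>
      (a ≠ tick ∧ ∃ μ, Step tick x a μ ∧ π = liftOp .async μ (PMF.pure y)) ∨
      (a ≠ tick ∧ ∃ ν, Step tick y a ν ∧ π = liftOp .async (PMF.pure x) ν) ∨
      (a = tick ∧ (∃ μ, Step tick x tick μ) ∧ (∃ ν, Step tick y tick ν) ∧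
        π = PMF.pure .nil)
  | .pasync p x y, a, π =>
      (a ≠ tick ∧ (¬ ∃ ν, Step tick y a ν) ∧
        ∃ μ, Step tick x a μ ∧ π = liftOp (.pasync p) μ (PMF.pure y)) ∨
      (a ≠ tick ∧ (¬ ∃ μ, Step tick x a μ) ∧
        ∃ ν, Step tick y a ν ∧ π = liftOp (.pasync p) (PMF.pure x) ν) ∨
      (a ≠ tick ∧ ∃ μ ν, Step tick x a μ ∧ Step tick y a ν ∧
        π = convexComb p (liftOp (.pasync p) μ (PMF.pure y))
          (liftOp (.pasync p) (PMF.pure x) ν)) ∨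
      (a = tick ∧ (∃ μ, Step tick x tick μ) ∧ (∃ ν, Step tick y tick ν) ∧
        π = PMF.pure .nil)
  | .csp B x y, a, π =>
      (a ∈ B \ {tick} ∧ ∃ μ ν, Step tick x a μ ∧ Step tick y a ν ∧
        π = liftOp (.csp B) μ ν) ∨
      (a = tick ∧ (∃ μ, Step tick x tick μ) ∧ (∃ ν, Step tick y tick ν) ∧
        π = PMF.pure .nil) ∨
      (a ∉ B ∪ {tick} ∧ ∃ μ, Step tick x a μ ∧ π = liftOp (.csp B) μ (PMF.pure y)) ∨
      (a ∉ B ∪ {tick} ∧ ∃ ν, Step tick y a ν ∧ π = liftOp (.csp B) (PMF.pure x) ν)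

/-- The `lam`-bisimilarity metric on processes. -/
def procDist {A : Type*} (tick : A) (lam : ℝ) (s t : Proc A) : ℝ :=
  bisimDist (Step tick) lam s t

/-- A binary process combinator is non-extensive if the distance of composed processes is at most
the maximum of the distances of the components. -/
def NonExtensive {A : Type*} (tick : A) (lam : ℝ) (f : Proc A → Proc A → Proc A) : Prop :=
  ∀ s₁ s₂ t₁ t₂ : Proc A, procDist tick lam (f s₁ s₂) (f t₁ t₂) ≤
    max (procDist tick lam s₁ t₁) (procDist tick lam s₂ t₂)

/-! ### The distance bounds, as functions of `e₁ = d(s₁, t₁)` and `e₂ = d(s₂, t₂)` -/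

/-- `dⁿ(e₁, e₂) = e₁ + lamⁿ (1 - e₁ / lam) e₂`. -/
def delayBound (lam : ℝ) (n : ℕ) (e₁ e₂ : ℝ) : ℝ :=
  e₁ + lam ^ n * (1 - e₁ / lam) * e₂

/-- The bound for sequential composition. -/
def seqBound (lam e₁ e₂ : ℝ) : ℝ :=
  if e₁ = 1 then 1 else max (delayBound lam 1 e₁ e₂) e₂

/-- The bound `d^s` for synchronous evolution. -/
def syncBound (lam e₁ e₂ : ℝ) : ℝ :=
  if e₁ = 1 ∨ e₂ = 1 then 1 else delayBound lam 0 e₁ e₂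

/-- The bound `d^a` for asynchronous evolution. -/
def asyncBound (lam e₁ e₂ : ℝ) : ℝ :=
  if e₁ = 1 ∨ e₂ = 1 then 1 else max (delayBound lam 2 e₁ e₂) (delayBound lam 2 e₂ e₁)

open Classical in
/-- The bound for the CSP-like parallel composition `∥_B`. -/
def cspBound {A : Type*} (tick : A) (B : Set A) (lam e₁ e₂ : ℝ) : ℝ :=
  if (B \ {tick}).Nonempty then syncBound lam e₁ e₂ else asyncBound lam e₁ e₂

end

/-! One family of processes witnesses all the bounds. With q = ε/λ, put s = a.([1-q]P ⊕ [q]0) +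
c.([1-q]P ⊕ [q]0) and t = a.P + c.P, where P = a.N + c₀.N + c₁.N and N = b.0. The label c is c₀ for
the first pair and c₁ for all others, and the first pair alone has ε as an additional summand of s,
t and P. A distance 1 is realised separately by a.0 + b.0 and 0. The only difference between s and t
is a deadlock of probability q after one step, and the deadlock is at distance 1 from P, so d(s,t) =
λq = ε.

For a binary operator the question is how many steps pass before the deadlock of the second pair
shows, given that the first one survived (probability 1-q₁). Synchronously it shows at once, because
both components must do a; the cost is λ(q₁ + (1-q₁)q₂). In s₁;s₂ the surviving P has to terminate
first, which exposes s₂ against t₂ one step later, at distance λq₂. Under interleaving a surviving P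
offers every label in use and so masks a deadlock of its partner until it has itself moved to N,
which costs two further discounts: d(P ||| s₂, P ||| t₂) = λ·λq₂. The private labels c₀, c₁
determine which component moves, and the label b of N reveals a step that was answered by the wrong
component. Termination is limited to the first pair so that it cannot defeat the masking.

These values are exact because every transition of t, and of P, leads to a Dirac distribution, where
the Kantorovich lifting is a plain expectation (`kantorovich_pure_right`). Upper bounds come from
exhibiting a simulation (`procDist_le_of_simulates`), lower bounds from one move all of whose
answers are expensive (`le_procDist`). Both rules need the least metric to be a bisimulation metric
itself. This holds since processes have bounded depth and finitely many transitions per action: the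
finite-step distances stabilise, and their limit is that metric (`bisimDist_eq_limitDist`).

The four parallel operators are handled together through `ParallelOp`; the moves outside the
synchronisation set are controlled by the general estimate d(f x y, f x' y') ≤ d(x,x') + d(y,y').
Taking all ε equal to λ/2 makes each bound for `;` and the parallel operators exceed λ/2, which
refutes non-extensiveness. -/

open scoped ENNReal

noncomputable section

/-! ### Expectations -/

/-- The expectation of `g` with respect to `μ`. -/
def mean {α : Type*} (μ : PMF α) (g : α → ℝ) : ℝ := ∑' x, g x * (μ x).toReal

section Mean

variable {α β : Type*}

theorem mean_eq_toReal (μ : PMF α) {g : α → ℝ} (h0 : ∀ x, 0 ≤ g x) :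
    mean μ g = (∑' x, ENNReal.ofReal (g x) * μ x).toReal := by
  rw [ENNReal.tsum_toReal_eq fun x => ENNReal.mul_ne_top ENNReal.ofReal_ne_top (μ.apply_ne_top x)]
  simp only [mean, ENNReal.toReal_mul, ENNReal.toReal_ofReal (h0 _)]

theorem summable_toReal (μ : PMF α) : Summable fun x => (μ x).toReal :=
  ENNReal.summable_toReal μ.tsum_coe_ne_top

theorem tsum_toReal (μ : PMF α) : ∑' x, (μ x).toReal = 1 := by
  rw [← ENNReal.tsum_toReal_eq μ.apply_ne_top, μ.tsum_coe, ENNReal.toReal_one]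

theorem summable_mul_toReal (μ : PMF α) {g : α → ℝ} (hg : ∀ x, g x ∈ Set.Icc (0 : ℝ) 1) :
    Summable fun x => g x * (μ x).toReal :=
  (summable_toReal μ).of_nonneg_of_le (fun x => mul_nonneg (hg x).1 ENNReal.toReal_nonneg)
    fun x => mul_le_of_le_one_left ENNReal.toReal_nonneg (hg x).2

theorem tsum_ofReal_mul_le_one (μ : PMF α) {g : α → ℝ} (hg : ∀ x, g x ∈ Set.Icc (0 : ℝ) 1) :
    ∑' x, ENNReal.ofReal (g x) * μ x ≤ 1 := by
  rw [← μ.tsum_coe]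
  exact ENNReal.tsum_le_tsum fun x =>
    mul_le_of_le_one_left zero_le (ENNReal.ofReal_le_one.2 (hg x).2)

theorem ofReal_mean (μ : PMF α) {g : α → ℝ} (hg : ∀ x, g x ∈ Set.Icc (0 : ℝ) 1) :
    ENNReal.ofReal (mean μ g) = ∑' x, ENNReal.ofReal (g x) * μ x := by
  rw [mean_eq_toReal μ fun x => (hg x).1, ENNReal.ofReal_toReal]
  exact ne_top_of_le_ne_top ENNReal.one_ne_top (tsum_ofReal_mul_le_one μ hg)

theorem mean_mem_Icc (μ : PMF α) {g : α → ℝ} (hg : ∀ x, g x ∈ Set.Icc (0 : ℝ) 1) :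
    mean μ g ∈ Set.Icc (0 : ℝ) 1 := by
  refine ⟨tsum_nonneg fun x => mul_nonneg (hg x).1 ENNReal.toReal_nonneg, ?_⟩
  rw [← ENNReal.ofReal_le_one, ofReal_mean μ hg]
  exact tsum_ofReal_mul_le_one μ hg

/-- Passing to `ENNReal` makes the exchange of the two sums unconditional. -/
theorem mean_bind (μ : PMF α) (k : α → PMF β) {g : β → ℝ} (hg : ∀ x, g x ∈ Set.Icc (0 : ℝ) 1) :
    mean (μ.bind k) g = mean μ fun x => mean (k x) g := by
  rw [mean_eq_toReal _ fun x => (hg x).1,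
    mean_eq_toReal _ fun x => (mean_mem_Icc (k x) hg).1]
  congr 1
  simp only [ofReal_mean _ hg, PMF.bind_apply, ← ENNReal.tsum_mul_left, ← ENNReal.tsum_mul_right]
  rw [ENNReal.tsum_comm]
  exact tsum_congr fun x => tsum_congr fun y => by ring

@[simp]
theorem mean_pure (x : α) (g : α → ℝ) : mean (PMF.pure x) g = g x := by
  rw [mean, tsum_eq_single x fun y hy => by simp [PMF.pure_apply, hy]]
  simp

theorem mean_map (μ : PMF α) (f : α → β) {g : β → ℝ} (hg : ∀ x, g x ∈ Set.Icc (0 : ℝ) 1) :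
    mean (μ.map f) g = mean μ fun x => g (f x) := by
  rw [← PMF.bind_pure_comp, mean_bind _ _ hg]
  simp

theorem mean_le_add_add (μ : PMF α) {g h k : α → ℝ} {e : ℝ} (hg : ∀ x, g x ∈ Set.Icc (0 : ℝ) 1)
    (hh : ∀ x, h x ∈ Set.Icc (0 : ℝ) 1) (hk : ∀ x, k x ∈ Set.Icc (0 : ℝ) 1)
    (hle : ∀ x ∈ μ.support, g x ≤ h x + k x + e) :
    mean μ g ≤ mean μ h + mean μ k + e := by
  have h1 : mean μ h + mean μ k + e = ∑' x, (h x + k x + e) * (μ x).toReal := by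
    simp only [add_mul]
    rw [((summable_mul_toReal μ hh).add (summable_mul_toReal μ hk)).tsum_add
      ((summable_toReal μ).mul_left e), (summable_mul_toReal μ hh).tsum_add
      (summable_mul_toReal μ hk), tsum_mul_left, tsum_toReal, mul_one, mean, mean]
  rw [h1]
  refine (summable_mul_toReal μ hg).tsum_le_tsum (fun x => ?_) ?_
  · by_cases hx : x ∈ μ.support
    · exact mul_le_mul_of_nonneg_right (hle x hx) ENNReal.toReal_nonneg
    · simp [(μ.apply_eq_zero_iff x).2 hx]
  · simp only [add_mul]
    exact ((summable_mul_toReal μ hh).add (summable_mul_toReal μ hk)).add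
      ((summable_toReal μ).mul_left e)

theorem mean_le_add (μ : PMF α) {g h : α → ℝ} {e : ℝ} (hg : ∀ x, g x ∈ Set.Icc (0 : ℝ) 1)
    (hh : ∀ x, h x ∈ Set.Icc (0 : ℝ) 1) (hle : ∀ x ∈ μ.support, g x ≤ h x + e) :
    mean μ g ≤ mean μ h + e := by
  have := mean_le_add_add (k := fun _ => 0) (e := e) μ hg hh (fun _ => by simp)
    (fun x hx => by simpa using hle x hx)
  simpa [mean] using this

theorem mean_mono (μ : PMF α) {g h : α → ℝ} (hg : ∀ x, g x ∈ Set.Icc (0 : ℝ) 1)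
    (hh : ∀ x, h x ∈ Set.Icc (0 : ℝ) 1) (hle : ∀ x ∈ μ.support, g x ≤ h x) :
    mean μ g ≤ mean μ h := by
  simpa using mean_le_add (e := 0) μ hg hh (fun x hx => by simpa using hle x hx)

theorem mean_le_of_le (μ : PMF α) {g : α → ℝ} {e : ℝ} (hg : ∀ x, g x ∈ Set.Icc (0 : ℝ) 1)
    (hle : ∀ x ∈ μ.support, g x ≤ e) : mean μ g ≤ e := by
  have := mean_le_add (h := fun _ => 0) (e := e) μ hg (fun _ => by simp)
    (fun x hx => by simpa using hle x hx)
  simpa [mean] using this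

theorem mean_fintype [Fintype α] (μ : PMF α) (g : α → ℝ) :
    mean μ g = ∑ x, g x * (μ x).toReal := tsum_fintype _

end Mean

/-! ### Binary mixtures -/

/-- The distribution on `Bool` that gives `true` the probability `q`. -/
def coin (q : Set.Icc (0 : ℝ) 1) : PMF Bool :=
  PMF.ofFintype (fun b => ENNReal.ofReal (cond b (q : ℝ) (1 - q))) (by
    rw [← ENNReal.ofReal_sum_of_nonneg]
    · simp
    · rintro (_ | _) _
      · simpa using q.2.2
      · exact q.2.1)

/-- The distribution that gives `y` the probability `q` and `x` the probability `1 - q`. -/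
def mix {S : Type*} (q : Set.Icc (0 : ℝ) 1) (x y : S) : PMF S :=
  (coin q).map fun b => cond b y x

section Mix

variable {S : Type*}

theorem mean_coin (q : Set.Icc (0 : ℝ) 1) (g : Bool → ℝ) :
    mean (coin q) g = (1 - q) * g false + q * g true := by
  have h1 : (0 : ℝ) ≤ 1 - q := sub_nonneg.2 q.2.2
  rw [mean_fintype]
  simp [coin, ENNReal.toReal_ofReal q.2.1, ENNReal.toReal_ofReal h1]
  ring

theorem mean_mix (q : Set.Icc (0 : ℝ) 1) (x y : S) {g : S → ℝ}
    (hg : ∀ x, g x ∈ Set.Icc (0 : ℝ) 1) :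
    mean (mix q x y) g = (1 - q) * g x + q * g y := by
  rw [mix, mean_map _ _ hg, mean_coin]
  rfl

theorem mix_zero (x y : S) : mix ⟨0, by simp⟩ x y = PMF.pure x := by
  ext z
  rw [mix, PMF.map_apply, tsum_fintype, PMF.pure_apply]
  simp [coin]

/-- Reduces `⊕_p` to a bind, so that joint convexity of the Kantorovich lifting applies. -/
theorem convexComb_eq_bind (p : Set.Ioo (0 : ℝ) 1) (μ ν : PMF S) :
    convexComb p μ ν = (coin ⟨p, Set.Ioo_subset_Icc_self p.2⟩).bind fun b => cond b μ ν := by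
  ext z
  rw [PMF.bind_apply, tsum_fintype]
  simp [coin]
  rfl

theorem mean_liftOp (f : S → S → S) (μ ν : PMF S) {g : S → ℝ}
    (hg : ∀ x, g x ∈ Set.Icc (0 : ℝ) 1) :
    mean (liftOp f μ ν) g = mean μ fun x => mean ν fun y => g (f x y) := by
  rw [liftOp, mean_bind _ _ hg]
  simp only [mean_map _ _ hg]

theorem liftOp_swap (f : S → S → S) (μ ν : PMF S) :
    liftOp (fun x y => f y x) μ ν = liftOp f ν μ := by
  simp only [liftOp, ← PMF.bind_pure_comp, Function.comp_def]
  exact PMF.bind_comm _ _ _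

@[simp]
theorem liftOp_pure_pure (f : S → S → S) (x y : S) :
    liftOp f (PMF.pure x) (PMF.pure y) = PMF.pure (f x y) := by
  simp [liftOp, PMF.pure_map]

theorem mem_support_liftOp {f : S → S → S} {μ ν : PMF S} {z : S} :
    z ∈ (liftOp f μ ν).support ↔ ∃ x ∈ μ.support, ∃ y ∈ ν.support, f x y = z := by
  simp [liftOp]

theorem mem_support_convexComb {p : Set.Ioo (0 : ℝ) 1} {μ ν : PMF S} {z : S}
    (hz : z ∈ (convexComb p μ ν).support) : z ∈ μ.support ∨ z ∈ ν.support := by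
  rw [convexComb_eq_bind, PMF.mem_support_bind_iff] at hz
  obtain ⟨b, -, hb⟩ := hz
  cases b
  · exact Or.inr hb
  · exact Or.inl hb

end Mix

/-! ### The Kantorovich lifting -/

section Kantorovich

variable {S : Type*} {d : S → S → ℝ}

theorem kantorovich_eq (d : S → S → ℝ) (π π' : PMF S) :
    kantorovich d π π' =
      sInf ((fun ω : PMF (S × S) => mean ω fun x => d x.1 x.2) '' matchings π π') := rfl

/-- The product of two distributions is a matching. -/
theorem matchings_nonempty (π π' : PMF S) : (matchings π π').Nonempty := by
  refine ⟨π.bind fun x => π'.map fun y => (x, y), ?_, ?_⟩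
  · simp [PMF.map_bind, PMF.map_comp, Function.comp_def]
    have : ∀ x : S, π'.map (fun _ => x) = PMF.pure x := fun x => PMF.map_const π' x
    simp [this]
  · simp [PMF.map_bind, PMF.map_comp, Function.comp_def]
    exact PMF.map_id π'

theorem support_of_mem_matchings {π π' : PMF S} {ω : PMF (S × S)} (hω : ω ∈ matchings π π')
    {x : S × S} (hx : x ∈ ω.support) : x.1 ∈ π.support ∧ x.2 ∈ π'.support := by
  rw [← hω.1, ← hω.2, PMF.mem_support_map_iff, PMF.mem_support_map_iff]
  exact ⟨⟨x, hx, rfl⟩, ⟨x, hx, rfl⟩⟩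

theorem IsBoundedPseudometric.mem_Icc (hd : IsBoundedPseudometric d) (x y : S) :
    d x y ∈ Set.Icc (0 : ℝ) 1 := ⟨hd.nonneg x y, hd.le_one x y⟩

theorem kantorovich_le_mean (hd : IsBoundedPseudometric d) {π π' : PMF S} {ω : PMF (S × S)}
    (hω : ω ∈ matchings π π') : kantorovich d π π' ≤ mean ω fun x => d x.1 x.2 := by
  rw [kantorovich_eq]
  refine csInf_le ⟨0, ?_⟩ ⟨ω, hω, rfl⟩
  rintro _ ⟨ω', -, rfl⟩
  exact (mean_mem_Icc ω' fun x => hd.mem_Icc x.1 x.2).1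

theorem le_kantorovich {π π' : PMF S} {c : ℝ}
    (h : ∀ ω ∈ matchings π π', c ≤ mean ω fun x => d x.1 x.2) : c ≤ kantorovich d π π' := by
  rw [kantorovich_eq]
  refine le_csInf ((matchings_nonempty π π').image _) ?_
  rintro _ ⟨ω, hω, rfl⟩
  exact h ω hω

theorem exists_matching_lt (d : S → S → ℝ) (π π' : PMF S) {e : ℝ} (he : 0 < e) :
    ∃ ω ∈ matchings π π', (mean ω fun x => d x.1 x.2) < kantorovich d π π' + e := by
  rw [kantorovich_eq]
  obtain ⟨_, ⟨ω, hω, rfl⟩, h⟩ :=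
    Real.lt_sInf_add_pos ((matchings_nonempty π π').image
      (fun ω : PMF (S × S) => mean ω fun x => d x.1 x.2)) he
  exact ⟨ω, hω, h⟩

theorem kantorovich_mem_Icc (hd : IsBoundedPseudometric d) (π π' : PMF S) :
    kantorovich d π π' ∈ Set.Icc (0 : ℝ) 1 := by
  refine ⟨le_kantorovich fun ω _ => (mean_mem_Icc ω fun x => hd.mem_Icc x.1 x.2).1, ?_⟩
  obtain ⟨ω, hω⟩ := matchings_nonempty π π'
  exact (kantorovich_le_mean hd hω).trans (mean_mem_Icc ω fun x => hd.mem_Icc x.1 x.2).2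

theorem kantorovich_self (hd : IsBoundedPseudometric d) (π : PMF S) : kantorovich d π π = 0 := by
  refine le_antisymm ?_ (kantorovich_mem_Icc hd π π).1
  have hω : π.map (fun x => (x, x)) ∈ matchings π π := by
    constructor <;> rw [PMF.map_comp] <;> exact PMF.map_id π
  refine (kantorovich_le_mean hd hω).trans ?_
  rw [mean_map _ _ fun x : S × S => hd.mem_Icc x.1 x.2]
  simp [hd.self, mean]

theorem swap_mem_matchings {π π' : PMF S} {ω : PMF (S × S)} (hω : ω ∈ matchings π π') :
    ω.map Prod.swap ∈ matchings π' π := by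
  constructor <;> rw [PMF.map_comp]
  · exact hω.2
  · exact hω.1

theorem kantorovich_comm (hd : IsBoundedPseudometric d) (π π' : PMF S) :
    kantorovich d π π' = kantorovich d π' π := by
  have key : ∀ π π' : PMF S, kantorovich d π π' ≤ kantorovich d π' π := fun π π' => by
    refine le_kantorovich fun ω hω => (kantorovich_le_mean hd (swap_mem_matchings hω)).trans ?_
    rw [mean_map _ _ fun x : S × S => hd.mem_Icc x.1 x.2]
    simp [hd.symm]
  exact le_antisymm (key _ _) (key _ _)

theorem kantorovich_mono {d' : S → S → ℝ} (hd : IsBoundedPseudometric d)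
    (hd' : IsBoundedPseudometric d') {π π' : PMF S}
    (h : ∀ x ∈ π.support, ∀ y ∈ π'.support, d x y ≤ d' x y) :
    kantorovich d π π' ≤ kantorovich d' π π' := by
  refine le_kantorovich fun ω hω => (kantorovich_le_mean hd hω).trans ?_
  refine mean_mono _ (fun x => hd.mem_Icc _ _) (fun x => hd'.mem_Icc _ _) fun x hx => ?_
  obtain ⟨h1, h2⟩ := support_of_mem_matchings hω hx
  exact h _ h1 _ h2

/-- Each coupling pays at least g of its first coordinate, whatever that coordinate is paired with.
This is the source of lower bounds that avoid computing optimal couplings. -/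
theorem mean_le_kantorovich (hd : IsBoundedPseudometric d) {π π' : PMF S} {g : S → ℝ}
    (hg : ∀ x, g x ∈ Set.Icc (0 : ℝ) 1)
    (h : ∀ x ∈ π.support, ∀ y ∈ π'.support, g x ≤ d x y) :
    mean π g ≤ kantorovich d π π' := by
  refine le_kantorovich fun ω hω => ?_
  nth_rw 1 [← hω.1]
  rw [mean_map _ _ hg]
  refine mean_mono _ (fun x => hg _) (fun x => hd.mem_Icc _ _) fun x hx => ?_
  obtain ⟨h1, h2⟩ := support_of_mem_matchings hω hx
  exact h _ h1 _ h2

/-- Against a Dirac distribution the coupling is forced, so the lifting is an expectation. -/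
theorem kantorovich_pure_right (hd : IsBoundedPseudometric d) (π : PMF S) (z : S) :
    kantorovich d π (PMF.pure z) = mean π fun x => d x z := by
  refine le_antisymm ?_ (mean_le_kantorovich hd (fun x => hd.mem_Icc _ _) ?_)
  · have hω : π.map (fun x => (x, z)) ∈ matchings π (PMF.pure z) := by
      constructor <;> rw [PMF.map_comp]
      · exact PMF.map_id π
      · exact PMF.map_const π z
    refine (kantorovich_le_mean hd hω).trans ?_
    rw [mean_map _ _ fun x : S × S => hd.mem_Icc x.1 x.2]
  · intro x _ y hy
    rw [(PMF.mem_support_pure_iff _ _).1 hy]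

/-- Joint convexity: mixing near-optimal couplings of the pieces with the common weights τ gives a
coupling of the mixtures. -/
theorem kantorovich_bind_le {I : Type*} (hd : IsBoundedPseudometric d) (τ : PMF I)
    (μ ν : I → PMF S) :
    kantorovich d (τ.bind μ) (τ.bind ν) ≤ mean τ fun i => kantorovich d (μ i) (ν i) := by
  refine le_of_forall_pos_le_add fun e he => ?_
  choose ω hω hlt using fun i => exists_matching_lt d (μ i) (ν i) he
  have hm : τ.bind ω ∈ matchings (τ.bind μ) (τ.bind ν) := by
    constructor <;> rw [PMF.map_bind] <;> congr 1 <;> funext i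
    · exact (hω i).1
    · exact (hω i).2
  refine (kantorovich_le_mean hd hm).trans ?_
  rw [mean_bind _ _ fun x : S × S => hd.mem_Icc x.1 x.2]
  exact mean_le_add _ (fun i => mean_mem_Icc _ fun x => hd.mem_Icc _ _)
    (fun i => kantorovich_mem_Icc hd _ _) fun i _ => (hlt i).le

/-- Disintegration of a distribution on a product along the first marginal. -/
theorem exists_kernel (ω : PMF (S × S)) :
    ∃ k : S → PMF S, (ω.map Prod.fst).bind (fun x => (k x).map fun y => (x, y)) = ω := by
  classical
  have hfst : ∀ x, (ω.map Prod.fst) x = ∑' y, ω (x, y) := fun x => by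
    rw [PMF.map_apply, ENNReal.tsum_prod', tsum_eq_single x]
    · simp
    · intro x' hx'
      simp [Ne.symm hx']
  have htop : ∀ x, ∑' y, ω (x, y) ≠ ∞ := fun x => hfst x ▸ PMF.apply_ne_top _ x
  -- Off the support of the first marginal the kernel is irrelevant; `PMF.pure x` is a dummy value.
  refine ⟨fun x => if h : ∑' y, ω (x, y) ≠ 0 then PMF.normalize (fun y => ω (x, y)) h (htop x)
    else PMF.pure x, ?_⟩
  ext ⟨x, y⟩
  rw [PMF.bind_apply, tsum_eq_single x]
  · rw [hfst]
    by_cases h : ∑' y, ω (x, y) = 0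
    · rw [h, zero_mul]
      exact (ENNReal.tsum_eq_zero.1 h y).symm
    · beta_reduce
      have hval : ((PMF.normalize (fun y => ω (x, y)) h (htop x)).map fun y => (x, y)) (x, y) =
          ω (x, y) * (∑' y, ω (x, y))⁻¹ := by
        rw [PMF.map_apply]
        refine (tsum_eq_single y fun z hz => ?_).trans ?_
        · simp [Ne.symm hz]
        · rw [if_pos rfl, PMF.normalize_apply]
      rw [dif_pos (show _ ≠ _ from h), hval, mul_comm, mul_assoc,
        ENNReal.inv_mul_cancel h (htop x), mul_one]
  · intro x' hx'
    rw [PMF.map_apply]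
    simp [Ne.symm hx']

/-- Gluing: two couplings with common middle marginal come from one law on triples, obtained by
disintegrating the second coupling along the middle coordinate. -/
theorem kantorovich_triangle (hd : IsBoundedPseudometric d) (π₁ π₂ π₃ : PMF S) :
    kantorovich d π₁ π₃ ≤ kantorovich d π₁ π₂ + kantorovich d π₂ π₃ := by
  have key : ∀ ω ∈ matchings π₁ π₂, ∀ ω' ∈ matchings π₂ π₃, kantorovich d π₁ π₃ ≤
      (mean ω fun x => d x.1 x.2) + mean ω' fun x => d x.1 x.2 := by
    intro ω hω ω' hω'
    obtain ⟨k, hk⟩ := exists_kernel ω'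
    rw [hω'.1, ← hω.2, PMF.bind_map] at hk
    let Ω : PMF ((S × S) × S) := ω.bind fun p => (k p.2).map fun z => (p, z)
    have hΩ₁ : Ω.map Prod.fst = ω := by
      have : ∀ p : S × S, (k p.2).map (fun _ => p) = PMF.pure p := fun p => PMF.map_const _ p
      simp [Ω, PMF.map_bind, PMF.map_comp, Function.comp_def, this]
    have hΩ₂ : Ω.map (fun q => (q.1.2, q.2)) = ω' := by
      rw [← hk]
      simp [Ω, PMF.map_bind, PMF.map_comp, Function.comp_def]
    have hm : Ω.map (fun q => (q.1.1, q.2)) ∈ matchings π₁ π₃ := by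
      constructor <;> rw [PMF.map_comp]
      · rw [← hω.1, ← hΩ₁, PMF.map_comp]
        rfl
      · rw [← hω'.2, ← hΩ₂, PMF.map_comp]
        rfl
    have hb : ∀ x : S × S, d x.1 x.2 ∈ Set.Icc (0 : ℝ) 1 := fun x => hd.mem_Icc _ _
    refine (kantorovich_le_mean hd hm).trans ?_
    have e₁ := (congrArg (fun m => mean m fun x => d x.1 x.2) hΩ₁).symm.trans (mean_map _ _ hb)
    have e₂ := (congrArg (fun m => mean m fun x => d x.1 x.2) hΩ₂).symm.trans (mean_map _ _ hb)
    rw [e₁, e₂, mean_map _ _ hb]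
    simpa using mean_le_add_add (e := 0) Ω (fun q => hb (q.1.1, q.2)) (fun q => hb q.1)
      (fun q => hb (q.1.2, q.2)) fun q _ => by simpa using hd.triangle q.1.1 q.1.2 q.2
  refine le_of_forall_pos_le_add fun e he => ?_
  obtain ⟨ω, hω, h1⟩ := exists_matching_lt d π₁ π₂ (half_pos he)
  obtain ⟨ω', hω', h2⟩ := exists_matching_lt d π₂ π₃ (half_pos he)
  linarith [key ω hω ω' hω']

/-- The independent product of two couplings is pushed forward by f. Asking for the estimate only on
supports makes this usable inside an induction on the depth of processes. -/
theorem kantorovich_liftOp_le (hd : IsBoundedPseudometric d) {f : S → S → S}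
    {μ μ' ν ν' : PMF S}
    (h : ∀ x ∈ μ.support, ∀ x' ∈ μ'.support, ∀ y ∈ ν.support, ∀ y' ∈ ν'.support,
      d (f x y) (f x' y') ≤ d x x' + d y y') :
    kantorovich d (liftOp f μ ν) (liftOp f μ' ν') ≤ kantorovich d μ μ' + kantorovich d ν ν' := by
  refine le_of_forall_pos_le_add fun e he => ?_
  obtain ⟨ω, hω, h1⟩ := exists_matching_lt d μ μ' (half_pos he)
  obtain ⟨ω', hω', h2⟩ := exists_matching_lt d ν ν' (half_pos he)
  have hb : ∀ x : S × S, d x.1 x.2 ∈ Set.Icc (0 : ℝ) 1 := fun x => hd.mem_Icc _ _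
  let Ω : PMF (S × S) := ω.bind fun p => ω'.map fun q => (f p.1 q.1, f p.2 q.2)
  have hm : Ω ∈ matchings (liftOp f μ ν) (liftOp f μ' ν') := by
    constructor
    · rw [← hω.1, ← hω'.1, liftOp, PMF.map_bind, PMF.bind_map]
      simp [PMF.map_comp, Function.comp_def]
    · rw [← hω.2, ← hω'.2, liftOp, PMF.map_bind, PMF.bind_map]
      simp [PMF.map_comp, Function.comp_def]
  have hle : (mean Ω fun x => d x.1 x.2) ≤
      (mean ω fun x => d x.1 x.2) + mean ω' fun x => d x.1 x.2 := by
    rw [mean_bind _ _ hb]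
    simp only [mean_map _ _ hb]
    refine mean_le_add _ (fun p => mean_mem_Icc _ fun q => hd.mem_Icc _ _) hb fun p hp => ?_
    rw [add_comm]
    refine mean_le_add _ (fun q => hd.mem_Icc _ _) hb fun q hq => ?_
    obtain ⟨h1, h2⟩ := support_of_mem_matchings hω hp
    obtain ⟨h3, h4⟩ := support_of_mem_matchings hω' hq
    rw [add_comm]
    exact h _ h1 _ h2 _ h3 _ h4
  linarith [kantorovich_le_mean hd hm]

theorem kantorovich_convexComb_le (hd : IsBoundedPseudometric d) (p : Set.Ioo (0 : ℝ) 1)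
    {μ μ' ν ν' : PMF S} {c : ℝ} (h1 : kantorovich d μ μ' ≤ c) (h2 : kantorovich d ν ν' ≤ c) :
    kantorovich d (convexComb p μ ν) (convexComb p μ' ν') ≤ c := by
  rw [convexComb_eq_bind, convexComb_eq_bind]
  refine (kantorovich_bind_le hd _ _ _).trans ?_
  refine mean_le_of_le _ (fun b => kantorovich_mem_Icc hd _ _) ?_
  rintro (_ | _) -
  · exact h2
  · exact h1

end Kantorovich
/-! ### The bisimilarity metric as a fixed point -/

section FixedPoint

variable {S A : Type*} {tr : S → A → PMF S → Prop} {lam : ℝ}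

/-- Every transition of `x` is matched by a transition of `y` at discounted distance at most
`c`. -/
def Simulates (tr : S → A → PMF S → Prop) (lam : ℝ) (d : S → S → ℝ) (c : ℝ) (x y : S) : Prop :=
  ∀ a π, tr x a π → ∃ π', tr y a π' ∧ lam * kantorovich d π π' ≤ c

/-- The admissible one-step distances of `x` and `y` relative to `d`. -/
def stepBounds (tr : S → A → PMF S → Prop) (lam : ℝ) (d : S → S → ℝ) (x y : S) : Set ℝ :=
  {c | 0 ≤ c ∧ (c = 1 ∨ c ≤ 1 ∧ Simulates tr lam d c x y ∧ Simulates tr lam d c y x)}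

/-- The least admissible one-step distance relative to `d`. -/
def stepDist (tr : S → A → PMF S → Prop) (lam : ℝ) (d : S → S → ℝ) (x y : S) : ℝ :=
  sInf (stepBounds tr lam d x y)

/-- The distance observable within `n` steps. -/
def approxDist (tr : S → A → PMF S → Prop) (lam : ℝ) : ℕ → S → S → ℝ
  | 0 => fun _ _ => 0
  | n + 1 => stepDist tr lam (approxDist tr lam n)

theorem one_mem_stepBounds (d : S → S → ℝ) (x y : S) : 1 ∈ stepBounds tr lam d x y :=
  ⟨zero_le_one, Or.inl rfl⟩

theorem stepDist_le {d : S → S → ℝ} {x y : S} {c : ℝ} (hc : c ∈ stepBounds tr lam d x y) :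
    stepDist tr lam d x y ≤ c :=
  csInf_le ⟨0, fun _ h => h.1⟩ hc

theorem Simulates.trans (hlam : 0 ≤ lam) {d : S → S → ℝ} (hd : IsBoundedPseudometric d)
    {x y z : S} {c c' : ℝ} (h : Simulates tr lam d c x y) (h' : Simulates tr lam d c' y z) :
    Simulates tr lam d (c + c') x z := by
  intro a π hπ
  obtain ⟨π', hπ', h1⟩ := h a π hπ
  obtain ⟨π'', hπ'', h2⟩ := h' a π' hπ'
  refine ⟨π'', hπ'', ?_⟩
  have := mul_le_mul_of_nonneg_left (kantorovich_triangle hd π π' π'') hlam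
  linarith

theorem isBoundedPseudometric_stepDist (hlam : 0 ≤ lam) {d : S → S → ℝ}
    (hd : IsBoundedPseudometric d) : IsBoundedPseudometric (stepDist tr lam d) where
  nonneg x y := Real.sInf_nonneg fun _ h => h.1
  le_one x y := stepDist_le (one_mem_stepBounds d x y)
  self x := by
    refine le_antisymm (stepDist_le ?_) (Real.sInf_nonneg fun _ h => h.1)
    have : Simulates tr lam d 0 x x := fun a π hπ => ⟨π, hπ, by rw [kantorovich_self hd, mul_zero]⟩
    exact ⟨le_rfl, Or.inr ⟨zero_le_one, this, this⟩⟩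
  symm x y := by
    have : stepBounds tr lam d x y = stepBounds tr lam d y x := by
      ext c
      simp only [stepBounds, Set.mem_ofPred_eq, and_comm (a := Simulates tr lam d c x y)]
    rw [stepDist, this, stepDist]
  triangle x y z := by
    refine le_of_forall_pos_le_add fun e he => ?_
    obtain ⟨c, hc, h1⟩ := Real.lt_sInf_add_pos ⟨1, one_mem_stepBounds (tr := tr) (lam := lam) d x y⟩
      (half_pos he)
    obtain ⟨c', hc', h2⟩ :=
      Real.lt_sInf_add_pos ⟨1, one_mem_stepBounds (tr := tr) (lam := lam) d y z⟩ (half_pos he)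
    have key : stepDist tr lam d x z ≤ c + c' := by
      rcases le_or_gt 1 (c + c') with h | h
      · exact (stepDist_le (one_mem_stepBounds d x z)).trans h
      · obtain ⟨h0, rfl | ⟨-, h3, h4⟩⟩ := hc
        · linarith [hc'.1]
        obtain ⟨h0', rfl | ⟨-, h5, h6⟩⟩ := hc'
        · linarith
        exact stepDist_le ⟨by linarith, Or.inr ⟨h.le, h3.trans hlam hd h5,
          add_comm c' c ▸ h6.trans hlam hd h4⟩⟩
    simp only [stepDist] at key ⊢
    linarith

theorem isBoundedPseudometric_approxDist (hlam : 0 ≤ lam) (n : ℕ) :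
    IsBoundedPseudometric (approxDist tr lam n) := by
  induction n with
  | zero => constructor <;> simp [approxDist]
  | succ n ih => exact isBoundedPseudometric_stepDist hlam ih

theorem kantorovich_congr {d d' : S → S → ℝ} (hd : IsBoundedPseudometric d)
    (hd' : IsBoundedPseudometric d') {π π' : PMF S}
    (h : ∀ x ∈ π.support, ∀ y ∈ π'.support, d x y = d' x y) :
    kantorovich d π π' = kantorovich d' π π' :=
  le_antisymm (kantorovich_mono hd hd' fun x hx y hy => (h x hx y hy).le)
    (kantorovich_mono hd' hd fun x hx y hy => (h x hx y hy).ge)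

/-- One step of the functional evaluates d only at pairs of successors; hence values at shallow
states determine values at deeper ones. -/
theorem stepDist_congr {d d' : S → S → ℝ} (hd : IsBoundedPseudometric d)
    (hd' : IsBoundedPseudometric d') {x y : S}
    (h : ∀ a π π', tr x a π → tr y a π' → ∀ u ∈ π.support, ∀ v ∈ π'.support, d u v = d' u v) :
    stepDist tr lam d x y = stepDist tr lam d' x y := by
  have key : ∀ c, (Simulates tr lam d c x y ↔ Simulates tr lam d' c x y) ∧
      (Simulates tr lam d c y x ↔ Simulates tr lam d' c y x) := by
    refine fun c => ⟨forall₃_congr fun a π hπ => exists_congr fun π' => and_congr_right fun hπ' => ?_,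
      forall₃_congr fun a π hπ => exists_congr fun π' => and_congr_right fun hπ' => ?_⟩
    · rw [kantorovich_congr hd hd' (h a π π' hπ hπ')]
    · rw [kantorovich_comm hd, kantorovich_comm hd', kantorovich_congr hd hd' (h a π' π hπ' hπ)]
  have : stepBounds tr lam d x y = stepBounds tr lam d' x y := by
    ext c
    simp only [stepBounds, Set.mem_ofPred_eq, (key c).1, (key c).2]
  rw [stepDist, this, stepDist]

/-- The transitions of a system decrease the rank. -/
def Descending (tr : S → A → PMF S → Prop) (rank : S → ℕ) : Prop :=
  ∀ x a π, tr x a π → ∀ y ∈ π.support, rank y < rank x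

variable {rank : S → ℕ}

/-- States of rank below N have no run of N transitions, so looking more than N steps ahead reveals
nothing new. -/
theorem approxDist_eq_of_le (hlam : 0 ≤ lam) (hr : Descending tr rank) {N : ℕ} :
    ∀ {x y : S}, rank x < N → rank y < N → ∀ {n : ℕ}, N ≤ n →
      approxDist tr lam n x y = approxDist tr lam N x y := by
  induction N with
  | zero => intro x y hx; omega
  | succ N ih =>
    intro x y hx hy n hn
    obtain ⟨n, rfl⟩ : ∃ k, n = k + 1 := ⟨n - 1, by omega⟩
    refine stepDist_congr (isBoundedPseudometric_approxDist hlam n)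
      (isBoundedPseudometric_approxDist hlam N) fun a π π' hπ hπ' u hu v hv => ?_
    have h1 := hr x a π hπ u hu
    have h2 := hr y a π' hπ' v hv
    exact ih (by omega) (by omega) (by omega)

/-- The eventual value of `approxDist`. -/
def limitDist (tr : S → A → PMF S → Prop) (lam : ℝ) (rank : S → ℕ) (x y : S) : ℝ :=
  approxDist tr lam (rank x + rank y + 1) x y

theorem limitDist_eq (hlam : 0 ≤ lam) (hr : Descending tr rank) {x y : S} {n : ℕ}
    (hx : rank x < n) (hy : rank y < n) : limitDist tr lam rank x y = approxDist tr lam n x y := by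
  have h1 : max (rank x) (rank y) + 1 ≤ rank x + rank y + 1 := by omega
  have h2 : max (rank x) (rank y) + 1 ≤ n := by omega
  rw [limitDist, approxDist_eq_of_le hlam hr (by omega) (by omega) h1,
    approxDist_eq_of_le hlam hr (by omega) (by omega) h2]

theorem isBoundedPseudometric_limitDist (hlam : 0 ≤ lam) (hr : Descending tr rank) :
    IsBoundedPseudometric (limitDist tr lam rank) where
  nonneg x y := (isBoundedPseudometric_approxDist hlam _).nonneg x y
  le_one x y := (isBoundedPseudometric_approxDist hlam _).le_one x y
  self x := (isBoundedPseudometric_approxDist hlam _).self x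
  symm x y := by
    rw [limitDist, limitDist, add_comm (rank y), (isBoundedPseudometric_approxDist hlam _).symm]
  triangle x y z := by
    have h := (isBoundedPseudometric_approxDist (tr := tr) hlam
      (rank x + rank y + rank z + 1)).triangle x y z
    rwa [← limitDist_eq hlam hr (by omega) (by omega), ← limitDist_eq hlam hr (by omega) (by omega),
      ← limitDist_eq hlam hr (by omega) (by omega)] at h

theorem limitDist_eq_stepDist (hlam : 0 ≤ lam) (hr : Descending tr rank) (x y : S) :
    limitDist tr lam rank x y = stepDist tr lam (limitDist tr lam rank) x y := by
  have hx : rank x < rank x + rank y + 1 + 1 := by omega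
  have hy : rank y < rank x + rank y + 1 + 1 := by omega
  rw [limitDist_eq hlam hr hx hy]
  refine stepDist_congr (isBoundedPseudometric_approxDist hlam _)
    (isBoundedPseudometric_limitDist hlam hr) fun a π π' hπ hπ' u hu v hv => ?_
  have h1 := hr x a π hπ u hu
  have h2 := hr y a π' hπ' v hv
  exact (limitDist_eq hlam hr (by omega) (by omega)).symm

/-- The step distance is an infimum of admissible c, and the answering transition may vary with c.
Image-finiteness provides one cheapest answer that serves all c. -/
theorem isBisimMetric_limitDist (hlam : 0 ≤ lam) (hr : Descending tr rank)
    (hfin : ∀ x a, {π | tr x a π}.Finite) : IsBisimMetric tr lam (limitDist tr lam rank) where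
  isBoundedPseudometric := isBoundedPseudometric_limitDist hlam hr
  transfer x y hxy a π hπ := by
    rw [limitDist_eq_stepDist hlam hr] at hxy ⊢
    obtain ⟨c, hc, hc1⟩ := (csInf_lt_iff ⟨0, fun _ h => h.1⟩ ⟨1, one_mem_stepBounds _ x y⟩).1 hxy
    obtain ⟨-, rfl | ⟨-, hsim, -⟩⟩ := hc
    · exact absurd hc1 (lt_irrefl _)
    obtain ⟨π₀, hπ₀, hle₀⟩ := hsim a π hπ
    obtain ⟨π', hπ', hmin⟩ := Set.exists_min_image {π | tr y a π}
      (fun π' => lam * kantorovich (limitDist tr lam rank) π π') (hfin y a) ⟨π₀, hπ₀⟩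
    refine ⟨π', hπ', le_csInf ⟨1, one_mem_stepBounds _ x y⟩ ?_⟩
    rintro c' ⟨-, rfl | ⟨-, hsim', -⟩⟩
    · exact ((hmin π₀ hπ₀).trans hle₀).trans hc1.le
    · obtain ⟨π₁, hπ₁, hle₁⟩ := hsim' a π hπ
      exact (hmin π₁ hπ₁).trans hle₁

theorem approxDist_le (hlam : 0 ≤ lam) {d : S → S → ℝ} (hd : IsBisimMetric tr lam d) (n : ℕ)
    (x y : S) : approxDist tr lam n x y ≤ d x y := by
  have hdp := hd.isBoundedPseudometric
  induction n generalizing x y with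
  | zero => exact hdp.nonneg x y
  | succ n ih =>
    have key : ∀ x y, d x y < 1 → Simulates tr lam (approxDist tr lam n) (d x y) x y := by
      intro x y hxy a π hπ
      obtain ⟨π', hπ', h⟩ := hd.transfer x y hxy a π hπ
      refine ⟨π', hπ', le_trans (mul_le_mul_of_nonneg_left ?_ hlam) h⟩
      exact kantorovich_mono (isBoundedPseudometric_approxDist hlam n) hdp
        fun u _ v _ => ih u v
    refine stepDist_le ⟨hdp.nonneg x y, ?_⟩
    rcases (hdp.le_one x y).lt_or_eq with h | h
    · have h' := key y x
      rw [hdp.symm y x] at h'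
      exact Or.inr ⟨h.le, key x y h, h' h⟩
    · exact Or.inl h

theorem bisimDist_eq_limitDist (hlam : 0 ≤ lam) (hr : Descending tr rank)
    (hfin : ∀ x a, {π | tr x a π}.Finite) : bisimDist tr lam = limitDist tr lam rank := by
  funext x y
  have hmem := isBisimMetric_limitDist hlam hr hfin
  refine le_antisymm (csInf_le ⟨0, ?_⟩ ⟨_, hmem, rfl⟩) (le_csInf ⟨_, _, hmem, rfl⟩ ?_)
  · rintro _ ⟨d, hd, rfl⟩
    exact hd.isBoundedPseudometric.nonneg x y
  · rintro _ ⟨d, hd, rfl⟩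
    exact approxDist_le hlam hd _ x y

theorem isBisimMetric_bisimDist (hlam : 0 ≤ lam) (hr : Descending tr rank)
    (hfin : ∀ x a, {π | tr x a π}.Finite) : IsBisimMetric tr lam (bisimDist tr lam) := by
  rw [bisimDist_eq_limitDist hlam hr hfin]
  exact isBisimMetric_limitDist hlam hr hfin

/-- Since the least metric is a fixed point, simulation relative to the metric itself bounds it; for
c > 1 the bound is vacuous. -/
theorem bisimDist_le_of_simulates (hlam : 0 ≤ lam) (hr : Descending tr rank)
    (hfin : ∀ x a, {π | tr x a π}.Finite) {x y : S} {c : ℝ} (hc : 0 ≤ c)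
    (h1 : Simulates tr lam (bisimDist tr lam) c x y)
    (h2 : Simulates tr lam (bisimDist tr lam) c y x) : bisimDist tr lam x y ≤ c := by
  rw [bisimDist_eq_limitDist hlam hr hfin] at *
  rcases le_total c 1 with h | h
  · rw [limitDist_eq_stepDist hlam hr]
    exact stepDist_le ⟨hc, Or.inr ⟨h, h1, h2⟩⟩
  · exact ((isBoundedPseudometric_limitDist hlam hr).le_one x y).trans h

end FixedPoint

/-! ### Processes form a descending, image-finite transition system -/

section Transitions

variable {A : Type*} {tick : A}

/-- A bound for the number of consecutive transitions of a process. -/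
def Proc.rank : Proc A → ℕ
  | .nil => 0
  | .skip => 1
  | .pre _ _ t => Finset.univ.sup (fun i => (t i).rank) + 1
  | .seq x y => x.rank + y.rank
  | .alt x y => max x.rank y.rank
  | .palt _ x y => max x.rank y.rank
  | .sync x y => x.rank + y.rank
  | .async x y => x.rank + y.rank
  | .pasync _ x y => x.rank + y.rank
  | .csp _ x y => x.rank + y.rank

theorem descending_step (tick : A) : Descending (Step tick) Proc.rank := by
  intro x
  induction x with
  | nil => rintro a π ⟨⟩
  | skip =>
    rintro a π ⟨-, rfl⟩ y hy
    rw [(PMF.mem_support_pure_iff _ _).1 hy]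
    simp [Proc.rank]
  | pre b p t ih =>
    rintro a π ⟨-, rfl⟩ y hy
    obtain ⟨i, -, rfl⟩ := (PMF.mem_support_map_iff _ _ _).1 hy
    exact Nat.lt_succ_of_le (Finset.le_sup (f := fun i => (t i).rank) (Finset.mem_univ i))
  | seq x y ihx ihy =>
    rintro a π (⟨-, μ, hμ, rfl⟩ | ⟨-, h⟩) z hz
    · obtain ⟨u, hu, v, hv, rfl⟩ := mem_support_liftOp.1 hz
      rw [(PMF.mem_support_pure_iff _ _).1 hv]
      have := ihx _ _ hμ u hu
      simp only [Proc.rank]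
      omega
    · have := ihy _ _ h z hz
      simp only [Proc.rank]
      omega
  | alt x y ihx ihy =>
    rintro a π (h | h) z hz
    · exact lt_max_of_lt_left (ihx _ _ h z hz)
    · exact lt_max_of_lt_right (ihy _ _ h z hz)
  | palt p x y ihx ihy =>
    rintro a π (⟨h, -⟩ | ⟨-, h⟩ | ⟨μ, ν, hμ, hν, rfl⟩) z hz
    · exact lt_max_of_lt_left (ihx _ _ h z hz)
    · exact lt_max_of_lt_right (ihy _ _ h z hz)
    · rcases mem_support_convexComb hz with hz | hz
      · exact lt_max_of_lt_left (ihx _ _ hμ z hz)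
      · exact lt_max_of_lt_right (ihy _ _ hν z hz)
  | sync x y ihx ihy =>
    rintro a π (⟨-, μ, ν, hμ, hν, rfl⟩ | ⟨-, ⟨μ, hμ⟩, -, rfl⟩) z hz
    · obtain ⟨u, hu, v, hv, rfl⟩ := mem_support_liftOp.1 hz
      have := ihx _ _ hμ u hu
      have := ihy _ _ hν v hv
      simp only [Proc.rank]
      omega
    -- `nil` has rank 0, so it suffices that x has positive rank, and its successor u shows this.
    · obtain ⟨u, hu⟩ := μ.support_nonempty
      have := ihx _ _ hμ u hu
      rw [(PMF.mem_support_pure_iff _ _).1 hz]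
      simp only [Proc.rank]
      omega
  | async x y ihx ihy =>
    rintro a π (⟨-, μ, hμ, rfl⟩ | ⟨-, ν, hν, rfl⟩ | ⟨-, ⟨μ, hμ⟩, -, rfl⟩) z hz
    · obtain ⟨u, hu, v, hv, rfl⟩ := mem_support_liftOp.1 hz
      rw [(PMF.mem_support_pure_iff _ _).1 hv]
      have := ihx _ _ hμ u hu
      simp only [Proc.rank]
      omega
    · obtain ⟨u, hu, v, hv, rfl⟩ := mem_support_liftOp.1 hz
      rw [(PMF.mem_support_pure_iff _ _).1 hu]
      have := ihy _ _ hν v hv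
      simp only [Proc.rank]
      omega
    · obtain ⟨u, hu⟩ := μ.support_nonempty
      have := ihx _ _ hμ u hu
      rw [(PMF.mem_support_pure_iff _ _).1 hz]
      simp only [Proc.rank]
      omega
  | pasync p x y ihx ihy =>
    have hl : ∀ a μ, Step tick x a μ → ∀ z ∈ (liftOp (.pasync p) μ (PMF.pure y)).support,
        z.rank < (Proc.pasync p x y).rank := by
      intro a μ hμ z hz
      obtain ⟨u, hu, v, hv, rfl⟩ := mem_support_liftOp.1 hz
      rw [(PMF.mem_support_pure_iff _ _).1 hv]
      have := ihx _ _ hμ u hu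
      simp only [Proc.rank]
      omega
    have hr : ∀ a ν, Step tick y a ν → ∀ z ∈ (liftOp (.pasync p) (PMF.pure x) ν).support,
        z.rank < (Proc.pasync p x y).rank := by
      intro a ν hν z hz
      obtain ⟨u, hu, v, hv, rfl⟩ := mem_support_liftOp.1 hz
      rw [(PMF.mem_support_pure_iff _ _).1 hu]
      have := ihy _ _ hν v hv
      simp only [Proc.rank]
      omega
    rintro a π (⟨-, -, μ, hμ, rfl⟩ | ⟨-, -, ν, hν, rfl⟩ | ⟨-, μ, ν, hμ, hν, rfl⟩ |
      ⟨-, ⟨μ, hμ⟩, -, rfl⟩) z hz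
    · exact hl _ _ hμ z hz
    · exact hr _ _ hν z hz
    · rcases mem_support_convexComb hz with hz | hz
      · exact hl _ _ hμ z hz
      · exact hr _ _ hν z hz
    · obtain ⟨u, hu⟩ := μ.support_nonempty
      have := ihx _ _ hμ u hu
      rw [(PMF.mem_support_pure_iff _ _).1 hz]
      simp only [Proc.rank]
      omega
  | csp B x y ihx ihy =>
    rintro a π (⟨-, μ, ν, hμ, hν, rfl⟩ | ⟨-, ⟨μ, hμ⟩, -, rfl⟩ | ⟨-, μ, hμ, rfl⟩ |
      ⟨-, ν, hν, rfl⟩) z hz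
    · obtain ⟨u, hu, v, hv, rfl⟩ := mem_support_liftOp.1 hz
      have := ihx _ _ hμ u hu
      have := ihy _ _ hν v hv
      simp only [Proc.rank]
      omega
    · obtain ⟨u, hu⟩ := μ.support_nonempty
      have := ihx _ _ hμ u hu
      rw [(PMF.mem_support_pure_iff _ _).1 hz]
      simp only [Proc.rank]
      omega
    · obtain ⟨u, hu, v, hv, rfl⟩ := mem_support_liftOp.1 hz
      rw [(PMF.mem_support_pure_iff _ _).1 hv]
      have := ihx _ _ hμ u hu
      simp only [Proc.rank]
      omega
    · obtain ⟨u, hu, v, hv, rfl⟩ := mem_support_liftOp.1 hz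
      rw [(PMF.mem_support_pure_iff _ _).1 hu]
      have := ihy _ _ hν v hv
      simp only [Proc.rank]
      omega

theorem finite_step (tick : A) (x : Proc A) (a : A) : {π | Step tick x a π}.Finite := by
  induction x with
  | nil => exact Set.finite_empty
  | skip => exact (Set.finite_singleton (PMF.pure (Proc.nil : Proc A))).subset fun π h => h.2
  | pre b p t => exact (Set.finite_singleton (p.toPMF.map t)).subset fun π h => h.2
  | seq x y ihx ihy =>
    refine ((ihx.image fun μ => liftOp .seq μ (PMF.pure y)).union ihy).subset ?_
    rintro π (⟨-, μ, hμ, rfl⟩ | ⟨-, h⟩)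
    · exact Or.inl ⟨μ, hμ, rfl⟩
    · exact Or.inr h
  | alt x y ihx ihy => exact ihx.union ihy
  | palt p x y ihx ihy =>
    refine ((ihx.union ihy).union (ihx.image2 (convexComb p) ihy)).subset ?_
    rintro π (⟨h, -⟩ | ⟨-, h⟩ | ⟨μ, ν, hμ, hν, rfl⟩)
    · exact Or.inl (Or.inl h)
    · exact Or.inl (Or.inr h)
    · exact Or.inr ⟨μ, hμ, ν, hν, rfl⟩
  | sync x y ihx ihy =>
    refine ((ihx.image2 (liftOp .sync) ihy).union (Set.finite_singleton (PMF.pure .nil))).subset ?_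
    rintro π (⟨-, μ, ν, hμ, hν, rfl⟩ | ⟨-, -, -, rfl⟩)
    · exact Or.inl ⟨μ, hμ, ν, hν, rfl⟩
    · exact Or.inr rfl
  | async x y ihx ihy =>
    refine (((ihx.image fun μ => liftOp .async μ (PMF.pure y)).union
      (ihy.image fun ν => liftOp .async (PMF.pure x) ν)).union
      (Set.finite_singleton (PMF.pure .nil))).subset ?_
    rintro π (⟨-, μ, hμ, rfl⟩ | ⟨-, ν, hν, rfl⟩ | ⟨-, -, -, rfl⟩)
    · exact Or.inl (Or.inl ⟨μ, hμ, rfl⟩)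
    · exact Or.inl (Or.inr ⟨ν, hν, rfl⟩)
    · exact Or.inr rfl
  | pasync p x y ihx ihy =>
    have hl := ihx.image fun μ => liftOp (.pasync p) μ (PMF.pure y)
    have hr := ihy.image fun ν => liftOp (.pasync p) (PMF.pure x) ν
    refine (((hl.union hr).union (hl.image2 (convexComb p) hr)).union
      (Set.finite_singleton (PMF.pure .nil))).subset ?_
    rintro π (⟨-, -, μ, hμ, rfl⟩ | ⟨-, -, ν, hν, rfl⟩ | ⟨-, μ, ν, hμ, hν, rfl⟩ | ⟨-, -, -, rfl⟩)
    · exact Or.inl (Or.inl (Or.inl ⟨μ, hμ, rfl⟩))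
    · exact Or.inl (Or.inl (Or.inr ⟨ν, hν, rfl⟩))
    · exact Or.inl (Or.inr ⟨_, ⟨μ, hμ, rfl⟩, _, ⟨ν, hν, rfl⟩, rfl⟩)
    · exact Or.inr rfl
  | csp B x y ihx ihy =>
    refine ((((ihx.image fun μ => liftOp (.csp B) μ (PMF.pure y)).union
      (ihy.image fun ν => liftOp (.csp B) (PMF.pure x) ν)).union
      (ihx.image2 (liftOp (.csp B)) ihy)).union
      (Set.finite_singleton (PMF.pure .nil))).subset ?_
    rintro π (⟨-, μ, ν, hμ, hν, rfl⟩ | ⟨-, -, -, rfl⟩ | ⟨-, μ, hμ, rfl⟩ | ⟨-, ν, hν, rfl⟩)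
    · exact Or.inl (Or.inr ⟨μ, hμ, ν, hν, rfl⟩)
    · exact Or.inr rfl
    · exact Or.inl (Or.inl (Or.inl ⟨μ, hμ, rfl⟩))
    · exact Or.inl (Or.inl (Or.inr ⟨ν, hν, rfl⟩))

end Transitions
-- Proof rules for upper and lower bounds on the distance of processes
section ProcDist

variable {A : Type*} {tick : A} {lam : ℝ}

/-- `x` has an `a`-transition. -/
def Can (tick : A) (x : Proc A) (a : A) : Prop := ∃ π, Step tick x a π

theorem isBisimMetric_procDist (hlam : lam ∈ Set.Ioc (0 : ℝ) 1) :
    IsBisimMetric (Step tick) lam (procDist tick lam) :=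
  isBisimMetric_bisimDist hlam.1.le (descending_step tick) (finite_step tick)

theorem isBoundedPseudometric_procDist (hlam : lam ∈ Set.Ioc (0 : ℝ) 1) :
    IsBoundedPseudometric (procDist tick lam) :=
  (isBisimMetric_procDist hlam).isBoundedPseudometric

theorem procDist_le_of_simulates (hlam : lam ∈ Set.Ioc (0 : ℝ) 1) {x y : Proc A} {c : ℝ}
    (hc : 0 ≤ c) (h1 : Simulates (Step tick) lam (procDist tick lam) c x y)
    (h2 : Simulates (Step tick) lam (procDist tick lam) c y x) : procDist tick lam x y ≤ c :=
  bisimDist_le_of_simulates hlam.1.le (descending_step tick) (finite_step tick) hc h1 h2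

theorem simulates_of_procDist_lt (hlam : lam ∈ Set.Ioc (0 : ℝ) 1) {x y : Proc A}
    (h : procDist tick lam x y < 1) :
    Simulates (Step tick) lam (procDist tick lam) (procDist tick lam x y) x y :=
  (isBisimMetric_procDist hlam).transfer x y h

theorem Can.of_procDist_lt (hlam : lam ∈ Set.Ioc (0 : ℝ) 1) {x y : Proc A}
    (h : procDist tick lam x y < 1) {a : A} (hx : Can tick x a) : Can tick y a := by
  obtain ⟨π, hπ⟩ := hx
  obtain ⟨π', hπ', -⟩ := simulates_of_procDist_lt hlam h a π hπ
  exact ⟨π', hπ'⟩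

theorem can_iff_of_procDist_lt (hlam : lam ∈ Set.Ioc (0 : ℝ) 1) {x y : Proc A}
    (h : procDist tick lam x y < 1) (a : A) : Can tick x a ↔ Can tick y a :=
  ⟨Can.of_procDist_lt hlam h,
    Can.of_procDist_lt hlam ((isBoundedPseudometric_procDist hlam).symm x y ▸ h)⟩

theorem procDist_eq_one (hlam : lam ∈ Set.Ioc (0 : ℝ) 1) {x y : Proc A} {a : A}
    (hx : Can tick x a) (hy : ¬ Can tick y a) : procDist tick lam x y = 1 := by
  refine le_antisymm ((isBoundedPseudometric_procDist hlam).le_one x y) (not_lt.1 fun h => ?_)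
  exact hy (hx.of_procDist_lt hlam h)

theorem procDist_eq_one' (hlam : lam ∈ Set.Ioc (0 : ℝ) 1) {x y : Proc A} {a : A}
    (hx : ¬ Can tick x a) (hy : Can tick y a) : procDist tick lam x y = 1 := by
  rw [(isBoundedPseudometric_procDist hlam).symm, procDist_eq_one hlam hy hx]

/-- The lower-bound rule: a single move suffices, provided that every answer to it costs at least c.
-/
theorem le_procDist (hlam : lam ∈ Set.Ioc (0 : ℝ) 1) {x y : Proc A} {a : A} {π : PMF (Proc A)}
    {c : ℝ} (hc : c ≤ 1) (hx : Step tick x a π)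
    (h : ∀ π', Step tick y a π' → c ≤ lam * kantorovich (procDist tick lam) π π') :
    c ≤ procDist tick lam x y := by
  rcases lt_or_ge (procDist tick lam x y) 1 with h1 | h1
  · obtain ⟨π', hπ', h2⟩ := simulates_of_procDist_lt hlam h1 a π hx
    exact (h π' hπ').trans h2
  · exact hc.trans h1

/-- Any answer with the right label costs at most λ·1. -/
theorem procDist_le_lam (hlam : lam ∈ Set.Ioc (0 : ℝ) 1) {x y : Proc A}
    (h : ∀ a, Can tick x a ↔ Can tick y a) : procDist tick lam x y ≤ lam := by
  have hd := isBoundedPseudometric_procDist (tick := tick) hlam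
  have key : ∀ x y : Proc A, (∀ a, Can tick x a ↔ Can tick y a) →
      Simulates (Step tick) lam (procDist tick lam) lam x y := by
    intro x y h a π hπ
    obtain ⟨π', hπ'⟩ := (h a).1 ⟨π, hπ⟩
    exact ⟨π', hπ', mul_le_of_le_one_right hlam.1.le (kantorovich_mem_Icc hd _ _).2⟩
  exact procDist_le_of_simulates hlam hlam.1.le (key x y h) (key y x fun a => (h a).symm)

theorem procDist_eq_zero_of_not_can (hlam : lam ∈ Set.Ioc (0 : ℝ) 1) {x y : Proc A}
    (hx : ∀ a, ¬ Can tick x a) (hy : ∀ a, ¬ Can tick y a) : procDist tick lam x y = 0 :=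
  le_antisymm (procDist_le_of_simulates hlam le_rfl (fun a π h => (hx a ⟨π, h⟩).elim)
    fun a π h => (hy a ⟨π, h⟩).elim) ((isBoundedPseudometric_procDist hlam).nonneg x y)

theorem Simulates.mono {x y : Proc A} {d : Proc A → Proc A → ℝ} {c c' : ℝ}
    (h : Simulates (Step tick) lam d c x y) (hc : c ≤ c') :
    Simulates (Step tick) lam d c' x y := fun a π hπ =>
  let ⟨π', hπ', hle⟩ := h a π hπ
  ⟨π', hπ', hle.trans hc⟩

theorem mul_kantorovich_convexComb_le (hlam : lam ∈ Set.Ioc (0 : ℝ) 1) (p : Set.Ioo (0 : ℝ) 1)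
    {μ μ' ν ν' : PMF (Proc A)} {c : ℝ}
    (h1 : lam * kantorovich (procDist tick lam) μ μ' ≤ c)
    (h2 : lam * kantorovich (procDist tick lam) ν ν' ≤ c) :
    lam * kantorovich (procDist tick lam) (convexComb p μ ν) (convexComb p μ' ν') ≤ c := by
  rw [← le_div_iff₀' hlam.1] at *
  exact kantorovich_convexComb_le (isBoundedPseudometric_procDist hlam) p h1 h2

/-! ### Non-expansiveness of prefixing and of the alternative compositions -/

theorem procDist_alt_le (hlam : lam ∈ Set.Ioc (0 : ℝ) 1) (x y x' y' : Proc A) :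
    procDist tick lam (.alt x y) (.alt x' y') ≤
      max (procDist tick lam x x') (procDist tick lam y y') := by
  have hd := isBoundedPseudometric_procDist (tick := tick) hlam
  have key : ∀ x y x' y' : Proc A, max (procDist tick lam x x') (procDist tick lam y y') < 1 →
      Simulates (Step tick) lam (procDist tick lam)
        (max (procDist tick lam x x') (procDist tick lam y y')) (.alt x y) (.alt x' y') := by
    rintro x y x' y' hlt a π (h | h)
    · obtain ⟨π', h1, h2⟩ := simulates_of_procDist_lt hlam (max_lt_iff.1 hlt).1 a π h
      exact ⟨π', Or.inl h1, h2.trans (le_max_left _ _)⟩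
    · obtain ⟨π', h1, h2⟩ := simulates_of_procDist_lt hlam (max_lt_iff.1 hlt).2 a π h
      exact ⟨π', Or.inr h1, h2.trans (le_max_right _ _)⟩
  rcases lt_or_ge (max (procDist tick lam x x') (procDist tick lam y y')) 1 with h | h
  · have h' := key x' y' x y
    rw [hd.symm x' x, hd.symm y' y] at h'
    exact procDist_le_of_simulates hlam (le_max_of_le_left (hd.nonneg _ _)) (key x y x' y' h) (h' h)
  · exact (hd.le_one _ _).trans h

/-- The negative premises cause no trouble, because processes at distance below 1 have the same
initial actions, so both sides use the same rule. -/
theorem procDist_palt_le (hlam : lam ∈ Set.Ioc (0 : ℝ) 1) (p : Set.Ioo (0 : ℝ) 1)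
    (x y x' y' : Proc A) :
    procDist tick lam (.palt p x y) (.palt p x' y') ≤
      max (procDist tick lam x x') (procDist tick lam y y') := by
  have hd := isBoundedPseudometric_procDist (tick := tick) hlam
  have key : ∀ x y x' y' : Proc A, max (procDist tick lam x x') (procDist tick lam y y') < 1 →
      Simulates (Step tick) lam (procDist tick lam)
        (max (procDist tick lam x x') (procDist tick lam y y')) (.palt p x y) (.palt p x' y') := by
    intro x y x' y' hlt a
    obtain ⟨hx, hy⟩ := max_lt_iff.1 hlt
    have sx := (simulates_of_procDist_lt hlam hx).mono
      (le_max_left (procDist tick lam x x') (procDist tick lam y y'))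
    have sy := (simulates_of_procDist_lt hlam hy).mono
      (le_max_right (procDist tick lam x x') (procDist tick lam y y'))
    rintro π (⟨h, hn⟩ | ⟨hn, h⟩ | ⟨μ, ν, hμ, hν, rfl⟩)
    · obtain ⟨π', h1, h2⟩ := sx a π h
      exact ⟨π', Or.inl ⟨h1, fun h => hn ((can_iff_of_procDist_lt hlam hy a).2 h)⟩, h2⟩
    · obtain ⟨π', h1, h2⟩ := sy a π h
      exact ⟨π', Or.inr (Or.inl ⟨fun h => hn ((can_iff_of_procDist_lt hlam hx a).2 h), h1⟩), h2⟩
    · obtain ⟨μ', h1, h2⟩ := sx a μ hμ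
      obtain ⟨ν', h3, h4⟩ := sy a ν hν
      exact ⟨_, Or.inr (Or.inr ⟨μ', ν', h1, h3, rfl⟩), mul_kantorovich_convexComb_le hlam p h2 h4⟩
  rcases lt_or_ge (max (procDist tick lam x x') (procDist tick lam y y')) 1 with h | h
  · have h' := key x' y' x y
    rw [hd.symm x' x, hd.symm y' y] at h'
    exact procDist_le_of_simulates hlam (le_max_of_le_left (hd.nonneg _ _)) (key x y x' y' h) (h' h)
  · exact (hd.le_one _ _).trans h

theorem mean_weights {m : ℕ} (p : Weights m) (g : Fin m → ℝ) :
    mean p.toPMF g = ∑ k, p.w k * g k := by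
  rw [mean_fintype]
  refine Finset.sum_congr rfl fun k _ => ?_
  rw [Weights.toPMF, PMF.ofFintype_apply, ENNReal.toReal_ofReal (p.pos k).le, mul_comm]

theorem procDist_pre_le (hlam : lam ∈ Set.Ioc (0 : ℝ) 1) (a : A) {m : ℕ} (p : Weights m)
    (s t : Fin m → Proc A) :
    procDist tick lam (.pre a p s) (.pre a p t) ≤
      lam * ∑ k, p.w k * procDist tick lam (s k) (t k) := by
  have hd := isBoundedPseudometric_procDist (tick := tick) hlam
  have key : ∀ s t : Fin m → Proc A, Simulates (Step tick) lam (procDist tick lam)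
      (lam * ∑ k, p.w k * procDist tick lam (s k) (t k)) (.pre a p s) (.pre a p t) := by
    rintro s t _ _ ⟨rfl, rfl⟩
    refine ⟨_, ⟨rfl, rfl⟩, mul_le_mul_of_nonneg_left ?_ hlam.1.le⟩
    rw [← PMF.bind_pure_comp, ← PMF.bind_pure_comp, ← mean_weights]
    refine (kantorovich_bind_le hd _ _ _).trans_eq ?_
    simp [kantorovich_pure_right hd]
  have h' := key t s
  simp only [hd.symm (t _) (s _)] at h'
  exact procDist_le_of_simulates hlam (mul_nonneg hlam.1.le (Finset.sum_nonneg fun k _ =>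
    mul_nonneg (p.pos k).le (hd.nonneg _ _))) (key s t) h'

/-! ### Matched pairs of processes -/

/-- The transitions of `x` and `x'` other than termination match up to `Q`, and both or none can
terminate. -/
structure Matched (tick : A) (Q : PMF (Proc A) → PMF (Proc A) → Prop) (x x' : Proc A) : Prop where
  tick_iff : Can tick x tick ↔ Can tick x' tick
  forth : ∀ a, a ≠ tick → ∀ μ, Step tick x a μ → ∃ μ', Step tick x' a μ' ∧ Q μ μ'
  back : ∀ a, a ≠ tick → ∀ μ', Step tick x' a μ' → ∃ μ, Step tick x a μ ∧ Q μ μ'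

variable {Q₁ Q₂ : PMF (Proc A) → PMF (Proc A) → Prop} {x x' y y' : Proc A}

theorem Matched.symm (h : Matched tick Q₁ x x') : Matched tick (fun μ μ' => Q₁ μ' μ) x' x :=
  ⟨h.tick_iff.symm, h.back, h.forth⟩

theorem Matched.can_iff (h : Matched tick Q₁ x x') (a : A) : Can tick x a ↔ Can tick x' a := by
  rcases eq_or_ne a tick with rfl | ha
  · exact h.tick_iff
  · exact ⟨fun ⟨μ, hμ⟩ => (h.forth a ha μ hμ).imp fun _ h => h.1,
      fun ⟨μ, hμ⟩ => (h.back a ha μ hμ).imp fun _ h => h.1⟩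

/-! ### Parallel composition operators -/

/-- `f` is a parallel composition: actions in `B` are performed synchronously, the other ones
asynchronously, where an action of both components is scheduled nondeterministically or with
fixed probabilities, and both components have to terminate together. -/
structure ParallelOp (tick : A) (B : Set A) (f : Proc A → Proc A → Proc A) : Prop where
  tick_iff : ∀ x y π, Step tick (f x y) tick π ↔
    Can tick x tick ∧ Can tick y tick ∧ π = PMF.pure .nil
  sync_iff : ∀ x y a π, a ≠ tick → a ∈ B → (Step tick (f x y) a π ↔
    ∃ μ ν, Step tick x a μ ∧ Step tick y a ν ∧ π = liftOp f μ ν)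
  left_iff : ∀ x y a π, a ≠ tick → a ∉ B → ¬ Can tick y a → (Step tick (f x y) a π ↔
    ∃ μ, Step tick x a μ ∧ π = liftOp f μ (PMF.pure y))
  right_iff : ∀ x y a π, a ≠ tick → a ∉ B → ¬ Can tick x a → (Step tick (f x y) a π ↔
    ∃ ν, Step tick y a ν ∧ π = liftOp f (PMF.pure x) ν)
  both_iff : (∀ x y a π, a ≠ tick → a ∉ B → Can tick x a → Can tick y a → (Step tick (f x y) a π ↔
      (∃ μ, Step tick x a μ ∧ π = liftOp f μ (PMF.pure y)) ∨
      ∃ ν, Step tick y a ν ∧ π = liftOp f (PMF.pure x) ν)) ∨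
    ∃ p, ∀ x y a π, a ≠ tick → a ∉ B → Can tick x a → Can tick y a → (Step tick (f x y) a π ↔
      ∃ μ ν, Step tick x a μ ∧ Step tick y a ν ∧
        π = convexComb p (liftOp f μ (PMF.pure y)) (liftOp f (PMF.pure x) ν))

variable {B : Set A} {f : Proc A → Proc A → Proc A}

theorem parallelOp_sync (tick : A) : ParallelOp tick Set.univ .sync where
  tick_iff x y π := by simp [Step, Can]
  sync_iff x y a π ha _ := by simp [Step, ha]
  left_iff x y a π _ h := (h trivial).elim
  right_iff x y a π _ h := (h trivial).elim
  both_iff := Or.inl fun x y a π _ h => (h trivial).elim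

theorem parallelOp_async (tick : A) : ParallelOp tick ∅ .async where
  tick_iff x y π := by simp [Step, Can]
  sync_iff x y a π _ h := h.elim
  left_iff x y a π ha _ h := by
    have : ∀ ν, ¬ Step tick y a ν := fun ν hν => h ⟨ν, hν⟩
    simp [Step, ha, this]
  right_iff x y a π ha _ h := by
    have : ∀ ν, ¬ Step tick x a ν := fun ν hν => h ⟨ν, hν⟩
    simp [Step, ha, this]
  both_iff := Or.inl fun x y a π ha _ _ _ => by simp [Step, ha]

theorem parallelOp_csp (tick : A) (B : Set A) : ParallelOp tick B (.csp B) where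
  tick_iff x y π := by simp [Step, Can]
  sync_iff x y a π ha h := by simp [Step, ha, h]
  left_iff x y a π ha hB h := by
    have : ∀ ν, ¬ Step tick y a ν := fun ν hν => h ⟨ν, hν⟩
    simp [Step, ha, hB, this]
  right_iff x y a π ha hB h := by
    have : ∀ ν, ¬ Step tick x a ν := fun ν hν => h ⟨ν, hν⟩
    simp [Step, ha, hB, this]
  both_iff := Or.inl fun x y a π ha hB _ _ => by simp [Step, ha, hB]

theorem parallelOp_pasync (tick : A) (p : Set.Ioo (0 : ℝ) 1) :
    ParallelOp tick ∅ (.pasync p) where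
  tick_iff x y π := by simp [Step, Can]
  sync_iff x y a π _ h := h.elim
  left_iff x y a π ha _ h := by
    have : ∀ ν, ¬ Step tick y a ν := fun ν hν => h ⟨ν, hν⟩
    simp [Step, ha, this]
  right_iff x y a π ha _ h := by
    have : ∀ ν, ¬ Step tick x a ν := fun ν hν => h ⟨ν, hν⟩
    simp [Step, ha, this]
  both_iff := Or.inr ⟨p, fun x y a π ha _ ⟨μ, hμ⟩ ⟨ν, hν⟩ => by
    have h1 : ∃ μ, Step tick x a μ := ⟨μ, hμ⟩
    have h2 : ∃ ν, Step tick y a ν := ⟨ν, hν⟩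
    simp only [Step, h1, h2]
    simp [ha]⟩

theorem convexComb_symm {S : Type*} (p : Set.Ioo (0 : ℝ) 1) (μ ν : PMF S) :
    convexComb p μ ν =
      convexComb ⟨1 - p, by linarith [p.2.2], by linarith [p.2.1]⟩ ν μ := by
  ext z
  change ENNReal.ofReal p * μ z + ENNReal.ofReal (1 - p) * ν z =
    ENNReal.ofReal (1 - p) * ν z + ENNReal.ofReal (1 - (1 - p)) * μ z
  rw [sub_sub_cancel, add_comm]

/-- Lets each statement about moves of the left component be reused for the right one; a scheduling
probability p turns into 1 - p. -/
theorem ParallelOp.swap (hf : ParallelOp tick B f) : ParallelOp tick B fun x y => f y x where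
  tick_iff x y π := by rw [hf.tick_iff, and_left_comm]
  sync_iff x y a π ha hB := by
    rw [hf.sync_iff _ _ _ _ ha hB]
    simp only [liftOp_swap]
    exact ⟨fun ⟨μ, ν, h1, h2, h⟩ => ⟨ν, μ, h2, h1, h⟩, fun ⟨μ, ν, h1, h2, h⟩ => ⟨ν, μ, h2, h1, h⟩⟩
  left_iff x y a π ha hB h := by
    rw [hf.right_iff _ _ _ _ ha hB h]
    simp only [liftOp_swap]
  right_iff x y a π ha hB h := by
    rw [hf.left_iff _ _ _ _ ha hB h]
    simp only [liftOp_swap]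
  both_iff := by
    rcases hf.both_iff with h | ⟨p, h⟩
    · refine Or.inl fun x y a π ha hB hx hy => ?_
      rw [h _ _ _ _ ha hB hy hx, or_comm]
      simp only [liftOp_swap]
    · refine Or.inr ⟨⟨1 - p, by linarith [p.2.2], by linarith [p.2.1]⟩,
        fun x y a π ha hB hx hy => ?_⟩
      rw [h _ _ _ _ ha hB hy hx]
      simp only [liftOp_swap, convexComb_symm p]
      exact ⟨fun ⟨μ, ν, h1, h2, h⟩ => ⟨ν, μ, h2, h1, h⟩, fun ⟨μ, ν, h1, h2, h⟩ => ⟨ν, μ, h2, h1, h⟩⟩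

theorem ParallelOp.can_tick_iff (hf : ParallelOp tick B f) :
    Can tick (f x y) tick ↔ Can tick x tick ∧ Can tick y tick :=
  ⟨fun ⟨_, h⟩ => ((hf.tick_iff x y _).1 h).imp_right And.left,
    fun h => ⟨_, (hf.tick_iff x y _).2 ⟨h.1, h.2, rfl⟩⟩⟩

theorem ParallelOp.can_sync_iff (hf : ParallelOp tick B f) {a : A} (ha : a ≠ tick) (hB : a ∈ B) :
    Can tick (f x y) a ↔ Can tick x a ∧ Can tick y a := by
  constructor
  · rintro ⟨π, h⟩
    obtain ⟨μ, ν, hμ, hν, -⟩ := (hf.sync_iff x y a π ha hB).1 h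
    exact ⟨⟨μ, hμ⟩, ⟨ν, hν⟩⟩
  · rintro ⟨⟨μ, hμ⟩, ⟨ν, hν⟩⟩
    exact ⟨_, (hf.sync_iff x y a _ ha hB).2 ⟨μ, ν, hμ, hν, rfl⟩⟩

theorem ParallelOp.can_async_iff (hf : ParallelOp tick B f) {a : A} (ha : a ≠ tick)
    (hB : a ∉ B) : Can tick (f x y) a ↔ Can tick x a ∨ Can tick y a := by
  by_cases hx : Can tick x a
  · obtain ⟨μ, hμ⟩ := hx
    by_cases hy : Can tick y a
    · obtain ⟨ν, hν⟩ := hy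
      refine ⟨fun _ => Or.inl ⟨μ, hμ⟩, fun _ => ?_⟩
      rcases hf.both_iff with h | ⟨p, h⟩
      · exact ⟨_, (h x y a _ ha hB ⟨μ, hμ⟩ ⟨ν, hν⟩).2 (Or.inl ⟨μ, hμ, rfl⟩)⟩
      · exact ⟨_, (h x y a _ ha hB ⟨μ, hμ⟩ ⟨ν, hν⟩).2 ⟨μ, ν, hμ, hν, rfl⟩⟩
    · exact ⟨fun _ => Or.inl ⟨μ, hμ⟩, fun _ => ⟨_, (hf.left_iff x y a _ ha hB hy).2 ⟨μ, hμ, rfl⟩⟩⟩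
  · constructor
    · rintro ⟨π, h⟩
      obtain ⟨ν, hν, -⟩ := (hf.right_iff x y a π ha hB hx).1 h
      exact Or.inr ⟨ν, hν⟩
    · rintro (h | ⟨ν, hν⟩)
      · exact (hx h).elim
      · exact ⟨_, (hf.right_iff x y a _ ha hB hx).2 ⟨ν, hν, rfl⟩⟩

/-- A move is joint, a move of one side, or a convex combination of one-sided moves. In the last
case the bounds `hl` and `hr` both hold, hence so does the bound for the mixture. Termination always
leads to `nil` and costs nothing. -/
theorem ParallelOp.simulates (hlam : lam ∈ Set.Ioc (0 : ℝ) 1) (hf : ParallelOp tick B f)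
    (hx : Matched tick Q₁ x x') (hy : Matched tick Q₂ y y') {c : ℝ} (hc : 0 ≤ c)
    (hs : (B \ {tick}).Nonempty → ∀ μ μ' ν ν', Q₁ μ μ' → Q₂ ν ν' →
      lam * kantorovich (procDist tick lam) (liftOp f μ ν) (liftOp f μ' ν') ≤ c)
    (hl : ∀ μ μ', Q₁ μ μ' → lam * kantorovich (procDist tick lam)
      (liftOp f μ (PMF.pure y)) (liftOp f μ' (PMF.pure y')) ≤ c)
    (hr : ∀ ν ν', Q₂ ν ν' → lam * kantorovich (procDist tick lam)
      (liftOp f (PMF.pure x) ν) (liftOp f (PMF.pure x') ν') ≤ c) :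
    Simulates (Step tick) lam (procDist tick lam) c (f x y) (f x' y') := by
  have hd := isBoundedPseudometric_procDist (tick := tick) hlam
  intro a π hπ
  rcases eq_or_ne a tick with rfl | ha
  · obtain ⟨h1, h2, rfl⟩ := (hf.tick_iff x y π).1 hπ
    exact ⟨_, (hf.tick_iff x' y' _).2 ⟨hx.tick_iff.1 h1, hy.tick_iff.1 h2, rfl⟩,
      by rwa [kantorovich_self hd, mul_zero]⟩
  by_cases hB : a ∈ B
  · obtain ⟨μ, ν, hμ, hν, rfl⟩ := (hf.sync_iff x y a π ha hB).1 hπ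
    obtain ⟨μ', hμ', h1⟩ := hx.forth a ha μ hμ
    obtain ⟨ν', hν', h2⟩ := hy.forth a ha ν hν
    exact ⟨_, (hf.sync_iff x' y' a _ ha hB).2 ⟨μ', ν', hμ', hν', rfl⟩,
      hs ⟨a, hB, ha⟩ μ μ' ν ν' h1 h2⟩
  by_cases hya : Can tick y a
  · have hya' := (hy.can_iff a).1 hya
    by_cases hxa : Can tick x a
    · have hxa' := (hx.can_iff a).1 hxa
      rcases hf.both_iff with h | ⟨p, h⟩
      · rcases (h x y a π ha hB hxa hya).1 hπ with ⟨μ, hμ, rfl⟩ | ⟨ν, hν, rfl⟩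
        · obtain ⟨μ', hμ', h1⟩ := hx.forth a ha μ hμ
          exact ⟨_, (h x' y' a _ ha hB hxa' hya').2 (Or.inl ⟨μ', hμ', rfl⟩), hl μ μ' h1⟩
        · obtain ⟨ν', hν', h1⟩ := hy.forth a ha ν hν
          exact ⟨_, (h x' y' a _ ha hB hxa' hya').2 (Or.inr ⟨ν', hν', rfl⟩), hr ν ν' h1⟩
      · obtain ⟨μ, ν, hμ, hν, rfl⟩ := (h x y a π ha hB hxa hya).1 hπ
        obtain ⟨μ', hμ', h1⟩ := hx.forth a ha μ hμ
        obtain ⟨ν', hν', h2⟩ := hy.forth a ha ν hν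
        exact ⟨_, (h x' y' a _ ha hB hxa' hya').2 ⟨μ', ν', hμ', hν', rfl⟩,
          mul_kantorovich_convexComb_le hlam p (hl μ μ' h1) (hr ν ν' h2)⟩
    · obtain ⟨ν, hν, rfl⟩ := (hf.right_iff x y a π ha hB hxa).1 hπ
      obtain ⟨ν', hν', h1⟩ := hy.forth a ha ν hν
      exact ⟨_, (hf.right_iff x' y' a _ ha hB (mt (hx.can_iff a).2 hxa)).2 ⟨ν', hν', rfl⟩,
        hr ν ν' h1⟩
  · obtain ⟨μ, hμ, rfl⟩ := (hf.left_iff x y a π ha hB hya).1 hπ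
    obtain ⟨μ', hμ', h1⟩ := hx.forth a ha μ hμ
    exact ⟨_, (hf.left_iff x' y' a _ ha hB (mt (hy.can_iff a).2 hya)).2 ⟨μ', hμ', rfl⟩,
      hl μ μ' h1⟩

theorem ParallelOp.procDist_le (hlam : lam ∈ Set.Ioc (0 : ℝ) 1) (hf : ParallelOp tick B f)
    (hx : Matched tick Q₁ x x') (hy : Matched tick Q₂ y y') {c : ℝ} (hc : 0 ≤ c)
    (hs : (B \ {tick}).Nonempty → ∀ μ μ' ν ν', Q₁ μ μ' → Q₂ ν ν' →
      lam * kantorovich (procDist tick lam) (liftOp f μ ν) (liftOp f μ' ν') ≤ c)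
    (hl : ∀ μ μ', Q₁ μ μ' → lam * kantorovich (procDist tick lam)
      (liftOp f μ (PMF.pure y)) (liftOp f μ' (PMF.pure y')) ≤ c)
    (hr : ∀ ν ν', Q₂ ν ν' → lam * kantorovich (procDist tick lam)
      (liftOp f (PMF.pure x) ν) (liftOp f (PMF.pure x') ν') ≤ c) :
    procDist tick lam (f x y) (f x' y') ≤ c := by
  have hd := isBoundedPseudometric_procDist (tick := tick) hlam
  refine procDist_le_of_simulates hlam hc (hf.simulates hlam hx hy hc hs hl hr)
    (hf.simulates hlam hx.symm hy.symm hc ?_ ?_ ?_)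
  · intro hB μ μ' ν ν' h1 h2
    rw [kantorovich_comm hd]
    exact hs hB _ _ _ _ h1 h2
  · intro μ μ' h1
    rw [kantorovich_comm hd]
    exact hl _ _ h1
  · intro μ μ' h1
    rw [kantorovich_comm hd]
    exact hr _ _ h1

/-- The rank conditions are carried along for the induction in `ParallelOp.procDist_le_add`. -/
theorem matched_of_procDist_lt (hlam : lam ∈ Set.Ioc (0 : ℝ) 1)
    (h : procDist tick lam x x' < 1) :
    Matched tick (fun μ μ' => lam * kantorovich (procDist tick lam) μ μ' ≤ procDist tick lam x x' ∧
      (∀ u ∈ μ.support, u.rank < x.rank) ∧ ∀ u ∈ μ'.support, u.rank < x'.rank) x x' where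
  tick_iff := can_iff_of_procDist_lt hlam h tick
  forth a _ μ hμ := by
    obtain ⟨μ', h1, h2⟩ := simulates_of_procDist_lt hlam h a μ hμ
    exact ⟨μ', h1, h2, descending_step tick x a μ hμ, descending_step tick x' a μ' h1⟩
  back a _ μ hμ := by
    have hd := isBoundedPseudometric_procDist (tick := tick) hlam
    rw [hd.symm] at h
    obtain ⟨μ', h1, h2⟩ := simulates_of_procDist_lt hlam h a μ hμ
    rw [kantorovich_comm hd, hd.symm] at h2
    exact ⟨μ', h1, h2, descending_step tick x a μ' h1, descending_step tick x' a μ hμ⟩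

/-- Parallel compositions are non-expansive. -/
theorem ParallelOp.procDist_le_add (hlam : lam ∈ Set.Ioc (0 : ℝ) 1) (hf : ParallelOp tick B f)
    (x y x' y' : Proc A) :
    procDist tick lam (f x y) (f x' y') ≤ procDist tick lam x x' + procDist tick lam y y' := by
  have hd := isBoundedPseudometric_procDist (tick := tick) hlam
  -- Each move lowers the rank of a component on either side, so the total rank drops even when the
  -- other component idles.
  induction hn : x.rank + x'.rank + y.rank + y'.rank using Nat.strong_induction_on
    generalizing x y x' y' with
  | _ n ih =>
    subst hn
    have hx0 := hd.nonneg x x'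
    have hy0 := hd.nonneg y y'
    rcases lt_or_ge (procDist tick lam x x') 1 with hx | hx
    swap
    · linarith [hd.le_one (f x y) (f x' y')]
    rcases lt_or_ge (procDist tick lam y y') 1 with hy | hy
    swap
    · linarith [hd.le_one (f x y) (f x' y')]
    -- An idle component contributes its distance times λ, which is at most the distance.
    have hlx := mul_le_of_le_one_left hx0 hlam.2
    have hly := mul_le_of_le_one_left hy0 hlam.2
    refine hf.procDist_le hlam (matched_of_procDist_lt hlam hx) (matched_of_procDist_lt hlam hy)
      (add_nonneg hx0 hy0) ?_ ?_ ?_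
    · rintro - μ μ' ν ν' ⟨h1, h2, h3⟩ ⟨h4, h5, h6⟩
      have := mul_le_mul_of_nonneg_left (kantorovich_liftOp_le (f := f) hd
        fun u hu u' hu' v hv v' hv' => ih _ (by
          have := h2 u hu; have := h3 u' hu'; have := h5 v hv; have := h6 v' hv'
          omega) u v u' v' rfl) hlam.1.le
      linarith
    · rintro μ μ' ⟨h1, h2, h3⟩
      have := mul_le_mul_of_nonneg_left (kantorovich_liftOp_le (f := f) (μ := μ) (μ' := μ')
        (ν := PMF.pure y) (ν' := PMF.pure y') hd
        fun u hu u' hu' v hv v' hv' => ih _ (by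
          have := h2 u hu; have := h3 u' hu'
          rw [(PMF.mem_support_pure_iff _ _).1 hv, (PMF.mem_support_pure_iff _ _).1 hv']
          omega) u v u' v' rfl) hlam.1.le
      rw [kantorovich_pure_right hd, mean_pure] at this
      linarith
    · rintro ν ν' ⟨h1, h2, h3⟩
      have := mul_le_mul_of_nonneg_left (kantorovich_liftOp_le (f := f) (ν := ν) (ν' := ν')
        (μ := PMF.pure x) (μ' := PMF.pure x') hd
        fun u hu u' hu' v hv v' hv' => ih _ (by
          have := h2 v hv; have := h3 v' hv'
          rw [(PMF.mem_support_pure_iff _ _).1 hu, (PMF.mem_support_pure_iff _ _).1 hu']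
          omega) u v u' v' rfl) hlam.1.le
      rw [kantorovich_pure_right hd, mean_pure] at this
      linarith

end ProcDist
/-! ### Test processes -/

section Gadget

variable {A : Type*} {tick : A} {lam : ℝ}

/-- `x` has exactly the transitions to `π₀` labelled by the actions in `I`, and a termination
transition if `τ` holds. -/
def HasSteps (tick : A) (τ : Bool) (I : Set A) (π₀ : PMF (Proc A)) (x : Proc A) : Prop :=
  ∀ a π, Step tick x a π ↔ (τ = true ∧ a = tick ∧ π = PMF.pure .nil) ∨ (a ∈ I ∧ π = π₀)

theorem HasSteps.can_iff {τ : Bool} {I : Set A} {π₀ : PMF (Proc A)} {x : Proc A}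
    (h : HasSteps tick τ I π₀ x) (a : A) : Can tick x a ↔ (τ = true ∧ a = tick) ∨ a ∈ I := by
  constructor
  · rintro ⟨π, hπ⟩
    rcases (h a π).1 hπ with ⟨h1, h2, -⟩ | ⟨h1, -⟩
    · exact Or.inl ⟨h1, h2⟩
    · exact Or.inr h1
  · rintro (⟨h1, h2⟩ | h1)
    · exact ⟨_, (h a _).2 (Or.inl ⟨h1, h2, rfl⟩)⟩
    · exact ⟨_, (h a _).2 (Or.inr ⟨h1, rfl⟩)⟩

theorem HasSteps.step {τ : Bool} {I : Set A} {π₀ : PMF (Proc A)} {x : Proc A}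
    (h : HasSteps tick τ I π₀ x) {a : A} (ha : a ∈ I) : Step tick x a π₀ :=
  (h a _).2 (Or.inr ⟨ha, rfl⟩)

theorem HasSteps.eq_of_step {τ : Bool} {I : Set A} {π₀ π : PMF (Proc A)} {x : Proc A}
    (h : HasSteps tick τ I π₀ x) {a : A} (ha : a ≠ tick) (hπ : Step tick x a π) : π = π₀ := by
  rcases (h a π).1 hπ with ⟨-, h2, -⟩ | ⟨-, h1⟩
  · exact (ha h2).elim
  · exact h1

theorem HasSteps.matched {τ : Bool} {I : Set A} {π₀ π₀' : PMF (Proc A)} {x x' : Proc A}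
    (h : HasSteps tick τ I π₀ x) (h' : HasSteps tick τ I π₀' x') :
    Matched tick (fun μ μ' => μ = π₀ ∧ μ' = π₀') x x' where
  tick_iff := by rw [h.can_iff, h'.can_iff]
  forth a ha μ hμ := by
    rcases (h a μ).1 hμ with ⟨-, h2, -⟩ | ⟨h1, h2⟩
    · exact (ha h2).elim
    · exact ⟨π₀', h'.step h1, h2, rfl⟩
  back a ha μ hμ := by
    rcases (h' a μ).1 hμ with ⟨-, h2, -⟩ | ⟨h1, h2⟩
    · exact (ha h2).elim
    · exact ⟨π₀, h.step h1, rfl, h2⟩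

theorem not_can_nil (a : A) : ¬ Can tick (.nil : Proc A) a := fun ⟨_, h⟩ => h

/-- A pair of processes `s`, `t` that perform the same actions `I` and then reach a process `P`
offering the actions `J`, except that `s` deadlocks instead with probability `q`. -/
structure Gadget (tick a : A) (J : Set A) (N : Proc A) where
  τ : Bool
  I : Set A
  q : Set.Icc (0 : ℝ) 1
  P : Proc A
  s : Proc A
  t : Proc A
  stepsP : HasSteps tick τ J (PMF.pure N) P
  stepsS : HasSteps tick τ I (mix q P .nil) s
  stepsT : HasSteps tick τ I (PMF.pure P) t
  mem : a ∈ I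
  subset : I ⊆ J
  tick_notMem : tick ∉ J

namespace Gadget

variable {a : A} {J : Set A} {N : Proc A} (X Y : Gadget tick a J N)

theorem mem_J (X : Gadget tick a J N) : a ∈ J := X.subset X.mem

theorem ne_tick (X : Gadget tick a J N) {c : A} (hc : c ∈ J) : c ≠ tick := fun h => X.tick_notMem (h ▸ hc)

theorem canP {c : A} (hc : c ∈ J) : Can tick X.P c := ⟨_, X.stepsP.step hc⟩

theorem canS {c : A} (hc : c ∈ X.I) : Can tick X.s c := ⟨_, X.stepsS.step hc⟩

theorem not_canS {c : A} (hc : c ≠ tick) (h : c ∉ X.I) : ¬ Can tick X.s c := by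
  rw [X.stepsS.can_iff]
  tauto

theorem not_canT {c : A} (hc : c ≠ tick) (h : c ∉ X.I) : ¬ Can tick X.t c := by
  rw [X.stepsT.can_iff]
  tauto

theorem not_canP {c : A} (hc : c ≠ tick) (h : c ∉ J) : ¬ Can tick X.P c := by
  rw [X.stepsP.can_iff]
  tauto

theorem one_sub_q_nonneg : (0 : ℝ) ≤ 1 - X.q := sub_nonneg.2 X.q.2.2

theorem kantorovich_mix_pure (hlam : lam ∈ Set.Ioc (0 : ℝ) 1) (q : Set.Icc (0 : ℝ) 1)
    (x y z : Proc A) : kantorovich (procDist tick lam) (mix q x y) (PMF.pure z) =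
      (1 - q) * procDist tick lam x z + q * procDist tick lam y z := by
  have hd := isBoundedPseudometric_procDist (tick := tick) hlam
  rw [kantorovich_pure_right hd, mean_mix _ _ _ fun x => hd.mem_Icc _ _]

theorem procDist_nil_P (hlam : lam ∈ Set.Ioc (0 : ℝ) 1) : procDist tick lam .nil X.P = 1 :=
  procDist_eq_one' hlam (not_can_nil a) (X.canP X.mem_J)

/-- Only the deadlock branch differs from P, and it does so at distance 1. -/
theorem kantorovich_succ (hlam : lam ∈ Set.Ioc (0 : ℝ) 1) :
    kantorovich (procDist tick lam) (mix X.q X.P .nil) (PMF.pure X.P) = X.q := by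
  rw [kantorovich_mix_pure hlam, (isBoundedPseudometric_procDist hlam).self,
    X.procDist_nil_P hlam]
  ring

theorem simulates_forth (hlam : lam ∈ Set.Ioc (0 : ℝ) 1) :
    Simulates (Step tick) lam (procDist tick lam) (lam * X.q) X.s X.t := by
  have hd := isBoundedPseudometric_procDist (tick := tick) hlam
  intro c π hπ
  rcases (X.stepsS c π).1 hπ with ⟨h1, h2, rfl⟩ | ⟨h1, rfl⟩
  · refine ⟨_, (X.stepsT c _).2 (Or.inl ⟨h1, h2, rfl⟩), ?_⟩
    rw [kantorovich_self hd, mul_zero]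
    exact mul_nonneg hlam.1.le X.q.2.1
  · exact ⟨_, X.stepsT.step h1, by rw [X.kantorovich_succ hlam]⟩

theorem simulates_back (hlam : lam ∈ Set.Ioc (0 : ℝ) 1) :
    Simulates (Step tick) lam (procDist tick lam) (lam * X.q) X.t X.s := by
  have hd := isBoundedPseudometric_procDist (tick := tick) hlam
  intro c π hπ
  rcases (X.stepsT c π).1 hπ with ⟨h1, h2, rfl⟩ | ⟨h1, rfl⟩
  · refine ⟨_, (X.stepsS c _).2 (Or.inl ⟨h1, h2, rfl⟩), ?_⟩
    rw [kantorovich_self hd, mul_zero]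
    exact mul_nonneg hlam.1.le X.q.2.1
  · exact ⟨_, X.stepsS.step h1, by rw [kantorovich_comm hd, X.kantorovich_succ hlam]⟩

theorem mul_q_le_one (hlam : lam ∈ Set.Ioc (0 : ℝ) 1) : lam * X.q ≤ 1 := mul_le_one₀ hlam.2 X.q.2.1 X.q.2.2

/-- Stated for two different pairs because a coupling under a prefix may match s of one pair with t
of another. The shared action `a` gives the bound: the deadlock of X is at distance 1 from any P. -/
theorem le_procDist_s_t (hlam : lam ∈ Set.Ioc (0 : ℝ) 1) : lam * X.q ≤ procDist tick lam X.s Y.t := by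
  have hd := isBoundedPseudometric_procDist (tick := tick) hlam
  refine le_procDist hlam (X.mul_q_le_one hlam) (X.stepsS.step X.mem) fun π' hπ' => ?_
  rw [Y.stepsT.eq_of_step (X.ne_tick X.mem_J) hπ', kantorovich_mix_pure hlam,
    Y.procDist_nil_P hlam, mul_one]
  have := mul_nonneg X.one_sub_q_nonneg (hd.nonneg X.P Y.P)
  exact mul_le_mul_of_nonneg_left (by linarith) hlam.1.le

theorem procDist_s_t (hlam : lam ∈ Set.Ioc (0 : ℝ) 1) : procDist tick lam X.s X.t = lam * X.q :=
  le_antisymm (procDist_le_of_simulates hlam (mul_nonneg hlam.1.le X.q.2.1)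
    (X.simulates_forth hlam) (X.simulates_back hlam)) (X.le_procDist_s_t X hlam)

/-! ### Alternative composition -/

variable {X Y} in
-- The label c is private to X, so the move of `X.s` can be answered only by `X.t`.
theorem le_procDist_alt (hlam : lam ∈ Set.Ioc (0 : ℝ) 1) {c : A} (hc : c ∈ X.I) (hc' : c ∉ Y.I) :
    lam * X.q ≤ procDist tick lam (.alt X.s Y.s) (.alt X.t Y.t) ∧
      lam * X.q ≤ procDist tick lam (.alt Y.s X.s) (.alt Y.t X.t) := by
  have hct := X.ne_tick (X.subset hc)
  constructor
  · refine le_procDist hlam (X.mul_q_le_one hlam) (Or.inl (X.stepsS.step hc)) ?_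
    rintro π' (h | h)
    · rw [X.stepsT.eq_of_step hct h, X.kantorovich_succ hlam]
    · exact (Y.not_canT hct hc' ⟨_, h⟩).elim
  · refine le_procDist hlam (X.mul_q_le_one hlam) (Or.inr (X.stepsS.step hc)) ?_
    rintro π' (h | h)
    · exact (Y.not_canT hct hc' ⟨_, h⟩).elim
    · rw [X.stepsT.eq_of_step hct h, X.kantorovich_succ hlam]

variable {X Y} in
theorem procDist_alt (hlam : lam ∈ Set.Ioc (0 : ℝ) 1) {c c' : A} (hc : c ∈ X.I) (hcY : c ∉ Y.I)
    (hc' : c' ∈ Y.I) (hcX : c' ∉ X.I) :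
    procDist tick lam (.alt X.s Y.s) (.alt X.t Y.t) = max (lam * X.q) (lam * Y.q) := by
  refine le_antisymm ?_ (max_le (le_procDist_alt hlam hc hcY).1 (le_procDist_alt hlam hc' hcX).2)
  rw [← X.procDist_s_t hlam, ← Y.procDist_s_t hlam]
  exact procDist_alt_le hlam _ _ _ _

variable {X Y} in
theorem le_procDist_palt (hlam : lam ∈ Set.Ioc (0 : ℝ) 1) (p : Set.Ioo (0 : ℝ) 1) {c : A}
    (hc : c ∈ X.I) (hc' : c ∉ Y.I) :
    lam * X.q ≤ procDist tick lam (.palt p X.s Y.s) (.palt p X.t Y.t) ∧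
      lam * X.q ≤ procDist tick lam (.palt p Y.s X.s) (.palt p Y.t X.t) := by
  have hct := X.ne_tick (X.subset hc)
  constructor
  · refine le_procDist hlam (X.mul_q_le_one hlam)
      (Or.inl ⟨X.stepsS.step hc, Y.not_canS hct hc'⟩) ?_
    rintro π' (⟨h, -⟩ | ⟨-, h⟩ | ⟨μ, ν, -, h, -⟩)
    · rw [X.stepsT.eq_of_step hct h, X.kantorovich_succ hlam]
    · exact (Y.not_canT hct hc' ⟨_, h⟩).elim
    · exact (Y.not_canT hct hc' ⟨_, h⟩).elim
  · refine le_procDist hlam (X.mul_q_le_one hlam)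
      (Or.inr (Or.inl ⟨Y.not_canS hct hc', X.stepsS.step hc⟩)) ?_
    rintro π' (⟨h, -⟩ | ⟨-, h⟩ | ⟨μ, ν, h, -, -⟩)
    · exact (Y.not_canT hct hc' ⟨_, h⟩).elim
    · rw [X.stepsT.eq_of_step hct h, X.kantorovich_succ hlam]
    · exact (Y.not_canT hct hc' ⟨_, h⟩).elim

variable {X Y} in
theorem procDist_palt (hlam : lam ∈ Set.Ioc (0 : ℝ) 1) (p : Set.Ioo (0 : ℝ) 1) {c c' : A}
    (hc : c ∈ X.I) (hcY : c ∉ Y.I) (hc' : c' ∈ Y.I) (hcX : c' ∉ X.I) :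
    procDist tick lam (.palt p X.s Y.s) (.palt p X.t Y.t) = max (lam * X.q) (lam * Y.q) := by
  refine le_antisymm ?_
    (max_le (le_procDist_palt hlam p hc hcY).1 (le_procDist_palt hlam p hc' hcX).2)
  rw [← X.procDist_s_t hlam, ← Y.procDist_s_t hlam]
  exact procDist_palt_le hlam p _ _ _ _

/-! ### Parallel composition -/

variable {B : Set A} {f : Proc A → Proc A → Proc A}

theorem kantorovich_liftOp_mix_pure (hlam : lam ∈ Set.Ioc (0 : ℝ) 1) (q : Set.Icc (0 : ℝ) 1)
    (x y u v z : Proc A) :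
    kantorovich (procDist tick lam) (liftOp f (mix q x y) (PMF.pure u))
      (liftOp f (PMF.pure v) (PMF.pure z)) =
      (1 - q) * procDist tick lam (f x u) (f v z) + q * procDist tick lam (f y u) (f v z) := by
  have hd := isBoundedPseudometric_procDist (tick := tick) hlam
  rw [liftOp_pure_pure, kantorovich_pure_right hd, mean_liftOp _ _ _ fun x => hd.mem_Icc _ _]
  simp only [mean_pure]
  rw [mean_mix _ _ _ fun x => hd.mem_Icc _ _]

theorem kantorovich_liftOp_pure_mix (hlam : lam ∈ Set.Ioc (0 : ℝ) 1) (q : Set.Icc (0 : ℝ) 1)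
    (x y u v z : Proc A) :
    kantorovich (procDist tick lam) (liftOp f (PMF.pure u) (mix q x y))
      (liftOp f (PMF.pure v) (PMF.pure z)) =
      (1 - q) * procDist tick lam (f u x) (f v z) + q * procDist tick lam (f u y) (f v z) := by
  have := kantorovich_liftOp_mix_pure (tick := tick) (f := fun x y => f y x) hlam q x y u z v
  rwa [liftOp_swap f, liftOp_swap f] at this

/-! ### Interleaving of two test pairs -/

section Async

variable {Z : Proc A}

/-- A partner that cannot do `a` does not hide the deadlock, so the distance stays that of the pair;
the upper bound is non-expansiveness. -/
theorem procDist_async_idle (hlam : lam ∈ Set.Ioc (0 : ℝ) 1) (hf : ParallelOp tick B f)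
    (haB : a ∉ B) (hZ : ¬ Can tick Z a) :
    procDist tick lam (f Z Y.s) (f Z Y.t) = lam * Y.q := by
  have hd := isBoundedPseudometric_procDist (tick := tick) hlam
  have ha := Y.ne_tick Y.mem_J
  refine le_antisymm ?_ ?_
  · have := hf.procDist_le_add hlam Z Y.s Z Y.t
    rwa [hd.self, zero_add, Y.procDist_s_t hlam] at this
  · refine le_procDist hlam (Y.mul_q_le_one hlam)
      ((hf.right_iff _ _ a _ ha haB hZ).2 ⟨_, Y.stepsS.step Y.mem, rfl⟩) fun π' hπ' => ?_
    obtain ⟨ν, hν, rfl⟩ := (hf.right_iff _ _ a _ ha haB hZ).1 hπ'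
    rw [Y.stepsT.eq_of_step ha hν, kantorovich_liftOp_pure_mix hlam, hd.self,
      procDist_eq_one' hlam (a := a), mul_zero, zero_add, mul_one]
    · rw [hf.can_async_iff ha haB]
      exact not_or.2 ⟨hZ, not_can_nil a⟩
    · rw [hf.can_async_iff ha haB]
      exact Or.inr (Y.canP Y.mem_J)

/-- `X.P` already offers all of J, so a deadlocked partner is not visible in the initial actions. By
`hτ` neither side can terminate. -/
theorem procDist_async_mask (hlam : lam ∈ Set.Ioc (0 : ℝ) 1) (hf : ParallelOp tick B f)
    (hB : ∀ c ∈ B, c = tick) (hτ : ¬ (X.τ = true ∧ Y.τ = true)) :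
    procDist tick lam (f X.P .nil) (f X.P Y.P) ≤ lam := by
  refine procDist_le_lam hlam fun c => ?_
  rcases eq_or_ne c tick with rfl | hc
  · rw [hf.can_tick_iff, hf.can_tick_iff, X.stepsP.can_iff, Y.stepsP.can_iff]
    have h1 := X.tick_notMem
    have h2 := not_can_nil (tick := c) c
    tauto
  · have hcB : c ∉ B := fun h => hc (hB c h)
    rw [hf.can_async_iff hc hcB, hf.can_async_iff hc hcB, X.stepsP.can_iff, Y.stepsP.can_iff]
    have h2 := not_can_nil (tick := tick) c
    tauto

/-- The gate `P` delays the difference of `s` and `t` by one step. -/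
theorem procDist_async_gate (hlam : lam ∈ Set.Ioc (0 : ℝ) 1) (hf : ParallelOp tick B f)
    (hB : ∀ c ∈ B, c = tick) (hτ : ¬ (X.τ = true ∧ Y.τ = true)) (hN : ¬ Can tick N a) {c : A}
    (hc : c ∈ X.I) (hcY : c ∉ Y.I) :
    procDist tick lam (f X.P Y.s) (f X.P Y.t) = lam * (lam * Y.q) := by
  have hd := isBoundedPseudometric_procDist (tick := tick) hlam
  have hct := X.ne_tick (X.subset hc)
  have ha := X.ne_tick X.mem_J
  have hcB : c ∉ B := fun h => hct (hB c h)
  have haB : a ∉ B := fun h => ha (hB a h)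
  have hidle := procDist_async_idle Y hlam hf haB hN
  have h0 : 0 ≤ lam * (lam * (Y.q : ℝ)) := mul_nonneg hlam.1.le (mul_nonneg hlam.1.le Y.q.2.1)
  refine le_antisymm ?_ ?_
  -- If P moves, it becomes N, which exposes the pair at distance λq. If Y moves, its deadlock
  -- branch has weight q and, being masked, costs at most λ. Both give λ·λq.
  · refine hf.procDist_le hlam (X.stepsP.matched X.stepsP) (Y.stepsS.matched Y.stepsT) h0 ?_ ?_ ?_
    · rintro ⟨d, hdB, hdt⟩
      exact (hdt (hB d hdB)).elim
    · rintro _ _ ⟨rfl, rfl⟩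
      rw [liftOp_pure_pure, liftOp_pure_pure, kantorovich_pure_right hd, mean_pure, hidle]
    · rintro _ _ ⟨rfl, rfl⟩
      rw [kantorovich_liftOp_pure_mix hlam, hd.self, mul_zero, zero_add, mul_comm lam (Y.q : ℝ)]
      exact mul_le_mul_of_nonneg_left (mul_le_mul_of_nonneg_left
        (procDist_async_mask X Y hlam hf hB hτ) Y.q.2.1) hlam.1.le
  -- The move of P under c is chosen, which Y cannot imitate.
  · refine le_procDist hlam (mul_le_one₀ hlam.2 (mul_nonneg hlam.1.le Y.q.2.1)
      (Y.mul_q_le_one hlam)) ((hf.left_iff _ _ c _ hct hcB (Y.not_canS hct hcY)).2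
        ⟨_, X.stepsP.step (X.subset hc), rfl⟩) fun π' hπ' => ?_
    obtain ⟨μ, hμ, rfl⟩ := (hf.left_iff _ _ c _ hct hcB (Y.not_canT hct hcY)).1 hπ'
    rw [X.stepsP.eq_of_step hct hμ, liftOp_pure_pure, liftOp_pure_pure, kantorovich_pure_right hd,
      mean_pure, hidle]

/-- If X survives, the remaining distance is the gated one; if it deadlocks, c is lost, as Y does
not offer it, and the distance is 1. -/
theorem kantorovich_async_left (hlam : lam ∈ Set.Ioc (0 : ℝ) 1) (hf : ParallelOp tick B f)
    (hB : ∀ c ∈ B, c = tick) (hτ : ¬ (X.τ = true ∧ Y.τ = true)) (hN : ¬ Can tick N a) {c : A}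
    (hc : c ∈ X.I) (hcY : c ∉ Y.I) :
    kantorovich (procDist tick lam) (liftOp f (mix X.q X.P .nil) (PMF.pure Y.s))
      (liftOp f (PMF.pure X.P) (PMF.pure Y.t)) = (1 - X.q) * (lam * (lam * Y.q)) + X.q := by
  have hct := X.ne_tick (X.subset hc)
  have hcB : c ∉ B := fun h => hct (hB c h)
  rw [kantorovich_liftOp_mix_pure hlam, procDist_async_gate X Y hlam hf hB hτ hN hc hcY,
    procDist_eq_one' hlam (a := c), mul_one]
  · rw [hf.can_async_iff hct hcB]
    exact not_or.2 ⟨not_can_nil c, Y.not_canS hct hcY⟩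
  · rw [hf.can_async_iff hct hcB]
    exact Or.inl (X.canP (X.subset hc))

theorem le_procDist_async (hlam : lam ∈ Set.Ioc (0 : ℝ) 1) (hf : ParallelOp tick B f)
    (hB : ∀ c ∈ B, c = tick) (hτ : ¬ (X.τ = true ∧ Y.τ = true)) (hN : ¬ Can tick N a) {c : A}
    (hc : c ∈ X.I) (hcY : c ∉ Y.I) :
    lam * ((1 - X.q) * (lam * (lam * Y.q)) + X.q) ≤
      procDist tick lam (f X.s Y.s) (f X.t Y.t) := by
  have hd := isBoundedPseudometric_procDist (tick := tick) hlam
  have hct := X.ne_tick (X.subset hc)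
  have hcB : c ∉ B := fun h => hct (hB c h)
  have hK := kantorovich_async_left X Y hlam hf hB hτ hN hc hcY
  refine le_procDist hlam ?_ ((hf.left_iff _ _ c _ hct hcB (Y.not_canS hct hcY)).2
        ⟨_, X.stepsS.step hc, rfl⟩) fun π' hπ' => ?_
  · rw [← hK]
    have := kantorovich_mem_Icc hd (liftOp f (mix X.q X.P .nil) (PMF.pure Y.s))
      (liftOp f (PMF.pure X.P) (PMF.pure Y.t))
    exact mul_le_one₀ hlam.2 this.1 this.2
  · obtain ⟨μ, hμ, rfl⟩ := (hf.left_iff _ _ c _ hct hcB (Y.not_canT hct hcY)).1 hπ'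
    rw [X.stepsT.eq_of_step hct hμ, hK]

/-- All non-terminating actions of a component lead to the same distribution, so every one-sided
move costs one of two values, also under the shared action `a`. The private labels force each value
in turn. -/
theorem procDist_async (hlam : lam ∈ Set.Ioc (0 : ℝ) 1) (hf : ParallelOp tick B f)
    (hB : ∀ c ∈ B, c = tick) (hτ : ¬ (X.τ = true ∧ Y.τ = true)) (hN : ¬ Can tick N a) {c c' : A}
    (hc : c ∈ X.I) (hcY : c ∉ Y.I) (hc' : c' ∈ Y.I) (hcX : c' ∉ X.I) :
    procDist tick lam (f X.s Y.s) (f X.t Y.t) =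
      max (lam * ((1 - X.q) * (lam * (lam * Y.q)) + X.q))
        (lam * ((1 - Y.q) * (lam * (lam * X.q)) + Y.q)) := by
  have hτ' : ¬ (Y.τ = true ∧ X.τ = true) := fun h => hτ h.symm
  refine le_antisymm ?_ (max_le (le_procDist_async X Y hlam hf hB hτ hN hc hcY)
    (le_procDist_async Y X hlam hf.swap hB hτ' hN hc' hcX))
  have h0 : 0 ≤ lam * ((1 - X.q) * (lam * (lam * Y.q)) + X.q) :=
    mul_nonneg hlam.1.le (add_nonneg (mul_nonneg X.one_sub_q_nonneg
      (mul_nonneg hlam.1.le (mul_nonneg hlam.1.le Y.q.2.1))) X.q.2.1)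
  refine hf.procDist_le hlam (X.stepsS.matched X.stepsT) (Y.stepsS.matched Y.stepsT)
    (le_max_of_le_left h0) ?_ ?_ ?_
  · rintro ⟨d, hdB, hdt⟩
    exact (hdt (hB d hdB)).elim
  · rintro _ _ ⟨rfl, rfl⟩
    rw [kantorovich_async_left X Y hlam hf hB hτ hN hc hcY]
    exact le_max_left _ _
  · rintro _ _ ⟨rfl, rfl⟩
    have := kantorovich_async_left Y X hlam hf.swap hB hτ' hN hc' hcX
    rw [liftOp_swap f, liftOp_swap f] at this
    rw [this]
    exact le_max_right _ _

end Async

/-- After a joint `a` a deadlock on either side blocks the next `a`, so the cost is the probability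
that at least one side is deadlocked. -/
theorem procDist_sync (hlam : lam ∈ Set.Ioc (0 : ℝ) 1) (hf : ParallelOp tick B f) (haB : a ∈ B) :
    procDist tick lam (f X.s Y.s) (f X.t Y.t) = lam * ((1 - X.q) * Y.q + X.q) := by
  have hd := isBoundedPseudometric_procDist (tick := tick) hlam
  have ha := X.ne_tick X.mem_J
  have hPP : Can tick (f X.P Y.P) a :=
    (hf.can_sync_iff ha haB).2 ⟨X.canP X.mem_J, Y.canP X.mem_J⟩
  have hl : ∀ v, procDist tick lam (f .nil v) (f X.P Y.P) = 1 := fun v =>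
    procDist_eq_one' hlam (fun h => not_can_nil a ((hf.can_sync_iff ha haB).1 h).1) hPP
  have hr : ∀ u, procDist tick lam (f u .nil) (f X.P Y.P) = 1 := fun u =>
    procDist_eq_one' hlam (fun h => not_can_nil a ((hf.can_sync_iff ha haB).1 h).2) hPP
  have hK : kantorovich (procDist tick lam) (liftOp f (mix X.q X.P .nil) (mix Y.q Y.P .nil))
      (liftOp f (PMF.pure X.P) (PMF.pure Y.P)) = (1 - X.q) * Y.q + X.q := by
    rw [liftOp_pure_pure, kantorovich_pure_right hd, mean_liftOp _ _ _ fun x => hd.mem_Icc _ _,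
      mean_mix _ _ _ fun x => mean_mem_Icc _ fun y => hd.mem_Icc _ _,
      mean_mix _ _ _ fun x => hd.mem_Icc _ _, mean_mix _ _ _ fun x => hd.mem_Icc _ _,
      hd.self, hl, hl, hr]
    ring
  have hX := X.q.2.1
  have hY := Y.q.2.1
  have hX1 := X.one_sub_q_nonneg
  have hY1 := Y.one_sub_q_nonneg
  refine le_antisymm ?_ ?_
  · refine hf.procDist_le hlam (X.stepsS.matched X.stepsT) (Y.stepsS.matched Y.stepsT)
      (mul_nonneg hlam.1.le (add_nonneg (mul_nonneg hX1 hY) hX)) ?_ ?_ ?_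
    · rintro - _ _ _ _ ⟨rfl, rfl⟩ ⟨rfl, rfl⟩
      rw [hK]
    -- Labels outside B may still interleave. Such a move costs no more than the joint one, since
    -- the pair that has not moved contributes at most λq ≤ q.
    · rintro _ _ ⟨rfl, rfl⟩
      have h1 := hf.procDist_le_add hlam X.P Y.s X.P Y.t
      rw [hd.self, zero_add, Y.procDist_s_t hlam] at h1
      have h2 := h1.trans (mul_le_of_le_one_left hY hlam.2)
      have h3 := mul_le_of_le_one_right hX (hd.le_one (f .nil Y.s) (f X.P Y.t))
      rw [kantorovich_liftOp_mix_pure hlam]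
      exact mul_le_mul_of_nonneg_left (add_le_add (mul_le_mul_of_nonneg_left h2 hX1) h3) hlam.1.le
    · rintro _ _ ⟨rfl, rfl⟩
      have h1 := hf.procDist_le_add hlam X.s Y.P X.t Y.P
      rw [hd.self, add_zero, X.procDist_s_t hlam] at h1
      have h2 := h1.trans (mul_le_of_le_one_left hX hlam.2)
      have h3 := mul_le_of_le_one_right hY (hd.le_one (f X.s .nil) (f X.t Y.P))
      rw [kantorovich_liftOp_pure_mix hlam]
      refine mul_le_mul_of_nonneg_left ((add_le_add (mul_le_mul_of_nonneg_left h2 hY1) h3).trans_eq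
        ?_) hlam.1.le
      ring
  · refine le_procDist hlam ?_ ((hf.sync_iff _ _ a _ ha haB).2
      ⟨_, _, X.stepsS.step X.mem, Y.stepsS.step Y.mem, rfl⟩) fun π' hπ' => ?_
    · rw [← hK]
      have := kantorovich_mem_Icc hd (liftOp f (mix X.q X.P .nil) (mix Y.q Y.P .nil))
        (liftOp f (PMF.pure X.P) (PMF.pure Y.P))
      exact mul_le_one₀ hlam.2 this.1 this.2
    · obtain ⟨μ, ν, hμ, hν, rfl⟩ := (hf.sync_iff _ _ a _ ha haB).1 hπ'
      rw [X.stepsT.eq_of_step ha hμ, Y.stepsT.eq_of_step ha hν, hK]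

/-! ### Sequential composition -/

theorem _root_.can_seq_iff {x y : Proc A} {c : A} : Can tick (.seq x y) c ↔
    (c ≠ tick ∧ Can tick x c) ∨ (Can tick x tick ∧ Can tick y c) := by
  constructor
  · rintro ⟨π, ⟨hc, μ, hμ, -⟩ | ⟨hx, hy⟩⟩
    · exact Or.inl ⟨hc, μ, hμ⟩
    · exact Or.inr ⟨hx, π, hy⟩
  · rintro (⟨hc, μ, hμ⟩ | ⟨hx, π, hy⟩)
    · exact ⟨_, Or.inl ⟨hc, μ, hμ, rfl⟩⟩
    · exact ⟨π, Or.inr ⟨hx, hy⟩⟩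

theorem _root_.simulates_seq {Q : PMF (Proc A) → PMF (Proc A) → Prop} {x x' y y' : Proc A} {e : ℝ}
    (hx : Matched tick Q x x') (hy : Simulates (Step tick) lam (procDist tick lam) e y y')
    (hl : ∀ μ μ', Q μ μ' → lam * kantorovich (procDist tick lam)
      (liftOp .seq μ (PMF.pure y)) (liftOp .seq μ' (PMF.pure y')) ≤ e) :
    Simulates (Step tick) lam (procDist tick lam) e (.seq x y) (.seq x' y') := by
  rintro c π (⟨hc, μ, hμ, rfl⟩ | ⟨hxt, hπ⟩)
  · obtain ⟨μ', hμ', h⟩ := hx.forth c hc μ hμ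
    exact ⟨_, Or.inl ⟨hc, μ', hμ', rfl⟩, hl μ μ' h⟩
  · obtain ⟨π', hπ', h⟩ := hy c π hπ
    exact ⟨π', Or.inr ⟨hx.tick_iff.1 hxt, hπ'⟩, h⟩

theorem _root_.procDist_seq_le (hlam : lam ∈ Set.Ioc (0 : ℝ) 1)
    {Q : PMF (Proc A) → PMF (Proc A) → Prop} {x x' y y' : Proc A} {e : ℝ} (he : 0 ≤ e)
    (hx : Matched tick Q x x') (hy : Simulates (Step tick) lam (procDist tick lam) e y y')
    (hy' : Simulates (Step tick) lam (procDist tick lam) e y' y)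
    (hl : ∀ μ μ', Q μ μ' → lam * kantorovich (procDist tick lam)
      (liftOp .seq μ (PMF.pure y)) (liftOp .seq μ' (PMF.pure y')) ≤ e) :
    procDist tick lam (.seq x y) (.seq x' y') ≤ e := by
  refine procDist_le_of_simulates hlam he (simulates_seq hx hy hl) (simulates_seq hx.symm hy' ?_)
  intro μ μ' h
  rw [kantorovich_comm (isBoundedPseudometric_procDist hlam)]
  exact hl _ _ h

section Seq

variable {b : A}

/-- Because P can terminate, the initial moves of `Y.s` and `Y.t` are exposed immediately; the moves
of P itself lead to N, behind which they are never reached. -/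
theorem procDist_seq_gate (hlam : lam ∈ Set.Ioc (0 : ℝ) 1)
    (hN : HasSteps tick false {b} (PMF.pure .nil) N) (hb : b ≠ tick) (hbJ : b ∉ J)
    (hτ : X.τ = true) :
    procDist tick lam (.seq X.P Y.s) (.seq X.P Y.t) = lam * Y.q := by
  have hd := isBoundedPseudometric_procDist (tick := tick) hlam
  have h0 : 0 ≤ lam * (Y.q : ℝ) := mul_nonneg hlam.1.le Y.q.2.1
  have ha := X.ne_tick X.mem_J
  have hnil : ∀ (y : Proc A) (c : A), ¬ Can tick (.seq .nil y) c := fun y c h => by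
    rcases can_seq_iff.1 h with ⟨-, h⟩ | ⟨h, -⟩ <;> exact not_can_nil _ h
  have hNt : ¬ Can tick N tick := by
    rw [hN.can_iff]
    simpa using hb.symm
  -- N cannot terminate: it does b and deadlocks, whatever follows it.
  have hNY : procDist tick lam (.seq N Y.s) (.seq N Y.t) = 0 := by
    have key : ∀ y y' : Proc A,
        Simulates (Step tick) lam (procDist tick lam) 0 (.seq N y) (.seq N y') := by
      rintro y y' c π (⟨hc, μ, hμ, rfl⟩ | ⟨h, -⟩)
      · refine ⟨_, Or.inl ⟨hc, μ, hμ, rfl⟩, ?_⟩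
        rw [hN.eq_of_step hc hμ, liftOp_pure_pure, liftOp_pure_pure, kantorovich_pure_right hd,
          mean_pure, procDist_eq_zero_of_not_can hlam (hnil _) (hnil _), mul_zero]
      · exact (hNt h).elim
    exact le_antisymm (procDist_le_of_simulates hlam le_rfl (key _ _) (key _ _)) (hd.nonneg _ _)
  have hPt : Can tick X.P tick := (X.stepsP.can_iff tick).2 (Or.inl ⟨hτ, rfl⟩)
  refine le_antisymm ?_ ?_
  · refine procDist_seq_le hlam h0 (X.stepsP.matched X.stepsP) (Y.simulates_forth hlam)
      (Y.simulates_back hlam) ?_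
    rintro _ _ ⟨rfl, rfl⟩
    rwa [liftOp_pure_pure, liftOp_pure_pure, kantorovich_pure_right hd, mean_pure, hNY, mul_zero]
  · refine le_procDist hlam (Y.mul_q_le_one hlam)
      (Or.inr ⟨hPt, Y.stepsS.step Y.mem⟩ : Step tick (.seq X.P Y.s) a _) ?_
    rintro π' (⟨hc, μ, hμ, rfl⟩ | ⟨-, h⟩)
    -- P could answer the `a` of `Y.s` with its own `a`, but then b becomes possible, which neither
    -- branch of the mixture offers. This is why N is not simply `nil`.
    · have hcan : Can tick (.seq N Y.t) b :=
        can_seq_iff.2 (Or.inl ⟨hb, (hN.can_iff b).2 (Or.inr rfl)⟩)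
      rw [X.stepsP.eq_of_step ha hμ, liftOp_pure_pure, kantorovich_mix_pure hlam,
        procDist_eq_one' hlam (Y.not_canP hb hbJ) hcan,
        procDist_eq_one' hlam (not_can_nil b) hcan]
      exact mul_le_mul_of_nonneg_left (by linarith [Y.q.2.2]) hlam.1.le
    · rw [Y.stepsT.eq_of_step ha h, Y.kantorovich_succ hlam]

/-- The move c of X yields the first term of the maximum. Since `X.s` may terminate at once, the
move c' of Y yields the second. -/
theorem procDist_seq (hlam : lam ∈ Set.Ioc (0 : ℝ) 1)
    (hN : HasSteps tick false {b} (PMF.pure .nil) N) (hb : b ≠ tick) (hbJ : b ∉ J)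
    (hτ : X.τ = true) {c c' : A} (hc : c ∈ X.I) (hcY : c ∉ Y.I) (hc' : c' ∈ Y.I)
    (hcX : c' ∉ X.I) :
    procDist tick lam (.seq X.s Y.s) (.seq X.t Y.t) =
      max (lam * ((1 - X.q) * (lam * Y.q) + X.q)) (lam * Y.q) := by
  have hd := isBoundedPseudometric_procDist (tick := tick) hlam
  have hct := X.ne_tick (X.subset hc)
  have hct' := Y.ne_tick (Y.subset hc')
  have ha := X.ne_tick X.mem_J
  have hK : kantorovich (procDist tick lam) (liftOp .seq (mix X.q X.P .nil) (PMF.pure Y.s))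
      (liftOp .seq (PMF.pure X.P) (PMF.pure Y.t)) = (1 - X.q) * (lam * Y.q) + X.q := by
    rw [kantorovich_liftOp_mix_pure hlam, procDist_seq_gate X Y hlam hN hb hbJ hτ,
      procDist_eq_one' hlam (a := a), mul_one]
    · rw [can_seq_iff]
      exact not_or.2 ⟨fun h => not_can_nil a h.2, fun h => not_can_nil tick h.1⟩
    · exact can_seq_iff.2 (Or.inl ⟨ha, X.canP X.mem_J⟩)
  have hSt : Can tick X.s tick := (X.stepsS.can_iff tick).2 (Or.inl ⟨hτ, rfl⟩)
  refine le_antisymm ?_ (max_le ?_ ?_)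
  · refine procDist_seq_le hlam (le_max_of_le_right (mul_nonneg hlam.1.le Y.q.2.1))
      (X.stepsS.matched X.stepsT) ((Y.simulates_forth hlam).mono (le_max_right _ _))
      ((Y.simulates_back hlam).mono (le_max_right _ _)) ?_
    rintro _ _ ⟨rfl, rfl⟩
    rw [hK]
    exact le_max_left _ _
  · refine le_procDist hlam ?_
      (Or.inl ⟨hct, _, X.stepsS.step hc, rfl⟩ : Step tick (.seq X.s Y.s) c _) ?_
    · rw [← hK]
      have := kantorovich_mem_Icc hd (liftOp .seq (mix X.q X.P .nil) (PMF.pure Y.s))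
        (liftOp .seq (PMF.pure X.P) (PMF.pure Y.t))
      exact mul_le_one₀ hlam.2 this.1 this.2
    · rintro π' (⟨-, μ, hμ, rfl⟩ | ⟨-, h⟩)
      · rw [X.stepsT.eq_of_step hct hμ, hK]
      · exact (Y.not_canT hct hcY ⟨_, h⟩).elim
  · refine le_procDist hlam (Y.mul_q_le_one hlam)
      (Or.inr ⟨hSt, Y.stepsS.step hc'⟩ : Step tick (.seq X.s Y.s) c' _) ?_
    rintro π' (⟨-, μ, hμ, rfl⟩ | ⟨-, h⟩)
    · exact (X.not_canT hct' hcX ⟨_, hμ⟩).elim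
    · rw [Y.stepsT.eq_of_step hct' h, Y.kantorovich_succ hlam]

end Seq
end Gadget
end Gadget
/-! ### Construction of the test processes -/

section Construction

variable {A : Type*} {tick : A}

/-- The weight `1` on a single branch. -/
def Weights.single : Weights 1 := ⟨fun _ => 1, fun _ => one_pos, by simp⟩

/-- The weights `1 - q` and `q` on two branches. -/
def Weights.pair (q : Set.Ioo (0 : ℝ) 1) : Weights 2 :=
  ⟨![1 - q, q], fun i => by
    fin_cases i
    · simpa using q.2.2
    · exact q.2.1, by simp⟩

open Classical in
/-- The prefix `a.([1 - q]x ⊕ [q]y)`, where branches of probability `0` are left out. -/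
def Proc.branch (a : A) (q : Set.Icc (0 : ℝ) 1) (x y : Proc A) : Proc A :=
  if h0 : (q : ℝ) = 0 then .pre a .single fun _ => x
  else if h1 : (q : ℝ) = 1 then .pre a .single fun _ => y
  else .pre a (.pair ⟨q, lt_of_le_of_ne q.2.1 (Ne.symm h0), lt_of_le_of_ne q.2.2 h1⟩) ![x, y]

theorem toPMF_single_map (x : Proc A) :
    (Weights.single.toPMF.map fun _ => x) = PMF.pure x := PMF.map_const _ x

theorem toPMF_pair_map (q : Set.Ioo (0 : ℝ) 1) (x y : Proc A) :
    (Weights.pair q).toPMF.map ![x, y] = mix ⟨q, Set.Ioo_subset_Icc_self q.2⟩ x y := by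
  ext z
  rw [mix, PMF.map_apply, PMF.map_apply, tsum_fintype, tsum_fintype, Fin.sum_univ_two,
    Fintype.sum_bool, add_comm]
  simp [Weights.toPMF, Weights.pair, coin]
  congr

theorem mix_one {S : Type*} (x y : S) : mix ⟨1, by simp⟩ x y = PMF.pure y := by
  ext z
  rw [mix, PMF.map_apply, tsum_fintype, PMF.pure_apply]
  simp [coin]

theorem step_branch (a : A) (q : Set.Icc (0 : ℝ) 1) (x y : Proc A) (c : A) (π : PMF (Proc A)) :
    Step tick (.branch a q x y) c π ↔ c = a ∧ π = mix q x y := by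
  obtain ⟨q, hq⟩ := q
  rw [Proc.branch]
  split_ifs with h0 h1
  · simp only at h0
    subst h0
    simp only [Step, toPMF_single_map, mix_zero]
  · simp only at h1
    subst h1
    simp only [Step, toPMF_single_map, mix_one]
  · simp only [Step, toPMF_pair_map]

/-- `ε` if `τ` holds, `0` otherwise. -/
def Proc.opt (τ : Bool) : Proc A := cond τ .skip .nil

theorem step_opt (τ : Bool) (c : A) (π : PMF (Proc A)) :
    Step tick (.opt τ) c π ↔ τ = true ∧ c = tick ∧ π = PMF.pure .nil := by
  cases τ <;> simp [Proc.opt, Step]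

/-- The process `a.x`. -/
def Proc.act (a : A) (x : Proc A) : Proc A := .pre a .single fun _ => x

theorem step_act (a : A) (x : Proc A) (c : A) (π : PMF (Proc A)) :
    Step tick (.act a x) c π ↔ c = a ∧ π = PMF.pure x := by
  simp only [Proc.act, Step, toPMF_single_map]

/-- The process `[ε +] a.N + c.N + c'.N`. -/
def Proc.gate (τ : Bool) (a c c' : A) (N : Proc A) : Proc A :=
  .alt (.opt τ) (.alt (.act a N) (.alt (.act c N) (.act c' N)))

theorem hasSteps_gate (τ : Bool) (a c c' : A) (N : Proc A) :
    HasSteps tick τ {a, c, c'} (PMF.pure N) (.gate τ a c c' N) := by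
  intro e π
  simp only [Proc.gate, Step, step_opt, step_act, Set.mem_insert_iff, Set.mem_singleton_iff]
  tauto

/-- The process `[ε +] a.([1 - q]P ⊕ [q]0) + c.([1 - q]P ⊕ [q]0)`. -/
def Proc.source (τ : Bool) (a c : A) (q : Set.Icc (0 : ℝ) 1) (P : Proc A) : Proc A :=
  .alt (.opt τ) (.alt (.branch a q P .nil) (.branch c q P .nil))

theorem hasSteps_source (τ : Bool) (a c : A) (q : Set.Icc (0 : ℝ) 1) (P : Proc A) :
    HasSteps tick τ {a, c} (mix q P .nil) (.source τ a c q P) := by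
  intro e π
  simp only [Proc.source, Step, step_opt, step_branch, Set.mem_insert_iff, Set.mem_singleton_iff]
  tauto

/-- The test pair with label `c`, termination flag `τ` and deadlock probability `q`. -/
def Gadget.ofLabel {a c₀ c₁ : A} (N : Proc A) (ht : tick ∉ ({a, c₀, c₁} : Set A)) (τ : Bool) {c : A}
    (hc : c ∈ ({c₀, c₁} : Set A)) (q : Set.Icc (0 : ℝ) 1) : Gadget tick a {a, c₀, c₁} N where
  τ := τ
  I := {a, c}
  q := q
  P := .gate τ a c₀ c₁ N
  s := .source τ a c q (.gate τ a c₀ c₁ N)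
  -- The case q = 0 of the same construction, whose mixture is the Dirac distribution at P.
  t := .source τ a c ⟨0, by simp⟩ (.gate τ a c₀ c₁ N)
  stepsP := hasSteps_gate τ a c₀ c₁ N
  stepsS := hasSteps_source τ a c q _
  stepsT := by
    have := hasSteps_source (tick := tick) τ a c ⟨0, by simp⟩ (.gate τ a c₀ c₁ N)
    rwa [mix_zero] at this
  mem := by simp
  subset := by
    rintro x (rfl | rfl)
    · simp
    · exact Or.inr hc
  tick_notMem := ht

end Construction

/-! ### The main theorem -/

section Main

variable {A : Type*} {tick : A} {lam : ℝ}

/-- With g x the least distance from x to any of the t j, each coupling costs at least the mean of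
g, and g is at least ε i at s i. So crosswise matching of branches cannot beat the diagonal one. -/
theorem lower_bound_pre (hlam : lam ∈ Set.Ioc (0 : ℝ) 1) {N : ℕ} {ε : Fin (N + 1) → ℝ}
    {s t : Fin (N + 1) → Proc A} (h : ∀ i j, ε i ≤ procDist tick lam (s i) (t j)) (a : A) {m : ℕ}
    (p : Weights m) (ι : Fin m → Fin (N + 1)) :
    lam * ∑ k, p.w k * ε (ι k) ≤
      procDist tick lam (.pre a p fun k => s (ι k)) (.pre a p fun k => t (ι k)) := by
  have hd := isBoundedPseudometric_procDist (tick := tick) hlam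
  have hg : ∀ x, (⨅ j, procDist tick lam x (t j)) ∈ Set.Icc (0 : ℝ) 1 := fun x =>
    ⟨le_ciInf fun j => hd.nonneg _ _,
      (ciInf_le (Set.finite_range _).bddBelow 0).trans (hd.le_one _ _)⟩
  have hsum : ∑ k, p.w k * ε (ι k) ≤ 1 := by
    rw [← p.sum_eq_one]
    exact Finset.sum_le_sum fun k _ => mul_le_of_le_one_right (p.pos k).le
      ((h (ι k) 0).trans (hd.le_one _ _))
  refine le_procDist hlam ?_ ⟨rfl, rfl⟩ ?_
  · nlinarith [hlam.1, hlam.2]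
  rintro _ ⟨-, rfl⟩
  refine mul_le_mul_of_nonneg_left ?_ hlam.1.le
  refine le_trans ?_ (mean_le_kantorovich hd hg ?_)
  · rw [mean_map _ _ hg, mean_weights]
    exact Finset.sum_le_sum fun k _ => mul_le_mul_of_nonneg_left
      (le_ciInf fun j => h (ι k) j) (p.pos k).le
  · intro x _ y hy
    obtain ⟨k, -, rfl⟩ := (PMF.mem_support_map_iff _ _ _).1 hy
    exact ciInf_le (Set.finite_range _).bddBelow (ι k)

/-- Four distinct actions other than `tick`, one of them in `B` if possible. -/
theorem exists_actions {n : ℕ} (hA : ∃ F : Finset A, tick ∉ F ∧ n + 4 ≤ F.card) (B : Set A) :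
    ∃ a b c₀ c₁ : A, tick ∉ ({a, c₀, c₁} : Set A) ∧ b ≠ tick ∧ b ∉ ({a, c₀, c₁} : Set A) ∧
      a ≠ c₀ ∧ a ≠ c₁ ∧ c₀ ≠ c₁ ∧ ((B \ {tick}).Nonempty → a ∈ B) := by
  classical
  obtain ⟨F, hF, hcard⟩ := hA
  obtain ⟨a, hat, haB⟩ : ∃ a, a ≠ tick ∧ ((B \ {tick}).Nonempty → a ∈ B) := by
    by_cases hB : (B \ {tick}).Nonempty
    · obtain ⟨a, ha⟩ := hB
      exact ⟨a, ha.2, fun _ => ha.1⟩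
    · obtain ⟨a, ha⟩ := Finset.card_pos.1 (show 0 < F.card by omega)
      exact ⟨a, fun h => hF (h ▸ ha), fun h => (hB h).elim⟩
  -- Here a need not lie in F, since it may have been taken from B; erasing it loses at most one
  -- element of at least four.
  have h3 : 2 < (F.erase a).card := by
    have := Finset.pred_card_le_card_erase (s := F) (a := a)
    omega
  obtain ⟨b, hb, c₀, hc₀, c₁, hc₁, h1, h2, h3⟩ := Finset.two_lt_card.1 h3
  have key : ∀ x ∈ F.erase a, x ≠ tick ∧ x ≠ a := fun x hx =>
    ⟨fun h => hF (h ▸ Finset.mem_of_mem_erase hx), Finset.ne_of_mem_erase hx⟩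
  refine ⟨a, b, c₀, c₁, ?_, (key b hb).1, ?_, (key c₀ hc₀).2.symm, (key c₁ hc₁).2.symm, h3, haB⟩
  · simp [hat.symm, (key c₀ hc₀).1.symm, (key c₁ hc₁).1.symm]
  · simp [(key b hb).2, h1, h2]

/-- The pair `s`, `t` is a gadget with deadlock probability `e / lam`, or, for `e = 1`, the
processes `s` and `t` differ in their initial actions. -/
def IsTestPair (tick a b : A) (J : Set A) (N : Proc A) (lam : ℝ) (τ : Bool) (I : Set A) (e : ℝ)
    (s t : Proc A) : Prop :=
  (e ≠ 1 ∧ ∃ X : Gadget tick a J N, X.τ = τ ∧ X.I = I ∧ X.s = s ∧ X.t = t ∧ lam * X.q = e) ∨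
  (e = 1 ∧ Can tick s a ∧ Can tick s b ∧ ∀ c, ¬ Can tick t c)

variable {a b : A} {J : Set A} {N : Proc A}

theorem exists_isTestPair (hlam : lam ∈ Set.Ioc (0 : ℝ) 1) {c₀ c₁ c : A}
    (ht : tick ∉ ({a, c₀, c₁} : Set A)) (τ : Bool) (hc : c ∈ ({c₀, c₁} : Set A)) {e : ℝ}
    (he : e ∈ Set.Icc (0 : ℝ) lam ∪ {1}) :
    ∃ s t : Proc A, IsTestPair tick a b {a, c₀, c₁} N lam τ {a, c} e s t := by
  -- The value 1 is split off even when λ = 1 would allow q = 1, because the bounds treat it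
  -- separately.
  by_cases h1 : e = 1
  · refine ⟨.alt (.act a .nil) (.act b .nil), .nil, Or.inr ⟨h1, ?_, ?_, not_can_nil⟩⟩
    · exact ⟨_, Or.inl ((step_act _ _ _ _).2 ⟨rfl, rfl⟩)⟩
    · exact ⟨_, Or.inr ((step_act _ _ _ _).2 ⟨rfl, rfl⟩)⟩
  · have he' : e ∈ Set.Icc (0 : ℝ) lam := he.resolve_right h1
    let q : Set.Icc (0 : ℝ) 1 := ⟨e / lam, div_nonneg he'.1 hlam.1.le, div_le_one_of_le₀ he'.2
      hlam.1.le⟩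
    exact ⟨_, _, Or.inl ⟨h1, Gadget.ofLabel N ht τ hc q, rfl, rfl, rfl, rfl,
      mul_div_cancel₀ e hlam.1.ne'⟩⟩

namespace IsTestPair

variable {τ τ' : Bool} {I I' : Set A} {e e' : ℝ} {s t s' t' : Proc A}

theorem can_s (h : IsTestPair tick a b J N lam τ I e s t) : Can tick s a := by
  obtain ⟨-, X, -, -, rfl, -, -⟩ | ⟨-, h, -⟩ := h
  · exact X.canS X.mem
  · exact h

theorem not_can_t (hb : b ≠ tick) (hbJ : b ∉ J) (h : IsTestPair tick a b J N lam τ I e s t) :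
    ¬ Can tick t b := by
  obtain ⟨-, X, -, -, -, rfl, -⟩ | ⟨-, -, -, h⟩ := h
  · exact X.not_canT hb fun h => hbJ (X.subset h)
  · exact h b

/-- Every s offers `a` and no t offers b; this settles the cases in which one of the two distances
is 1. -/
theorem le_procDist (hlam : lam ∈ Set.Ioc (0 : ℝ) 1) (hb : b ≠ tick) (hbJ : b ∉ J)
    (h : IsTestPair tick a b J N lam τ I e s t) (h' : IsTestPair tick a b J N lam τ' I' e' s' t') :
    e ≤ procDist tick lam s t' := by
  have hsa := h.can_s
  obtain ⟨-, X, -, -, rfl, -, rfl⟩ | ⟨rfl, -, hsb, -⟩ := h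
  · obtain ⟨-, Y, -, -, -, rfl, -⟩ | ⟨-, -, -, h'⟩ := h'
    · exact X.le_procDist_s_t Y hlam
    · rw [procDist_eq_one hlam hsa (h' a)]
      exact X.mul_q_le_one hlam
  · rw [procDist_eq_one hlam hsb (h'.not_can_t hb hbJ)]

theorem procDist_eq (hlam : lam ∈ Set.Ioc (0 : ℝ) 1)
    (h : IsTestPair tick a b J N lam τ I e s t) : procDist tick lam s t = e := by
  obtain ⟨-, X, -, -, rfl, rfl, rfl⟩ | ⟨rfl, -, hsb, ht⟩ := h
  · exact X.procDist_s_t hlam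
  · exact procDist_eq_one hlam hsb (ht b)

theorem le_one (hlam : lam ∈ Set.Ioc (0 : ℝ) 1) (h : IsTestPair tick a b J N lam τ I e s t) :
    e ≤ 1 :=
  h.procDist_eq hlam ▸ (isBoundedPseudometric_procDist hlam).le_one s t

theorem procDist_async (hlam : lam ∈ Set.Ioc (0 : ℝ) 1)
    (h : IsTestPair tick a b J N lam τ I e s t) (h' : IsTestPair tick a b J N lam τ' I' e' s' t')
    (hb : b ≠ tick) (hbJ : b ∉ J) (hN : ¬ Can tick N a) (hτ : ¬ (τ = true ∧ τ' = true)) {c c' : A}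
    (hc : c ∈ I) (hcY : c ∉ I') (hc' : c' ∈ I') (hcX : c' ∉ I)
    {B : Set A} {f : Proc A → Proc A → Proc A} (hf : ParallelOp tick B f)
    (hB : ∀ c ∈ B, c = tick) :
    procDist tick lam (f s s') (f t t') = asyncBound lam e e' := by
  -- Under interleaving b stays visible if either s offers it, so it detects a component at distance
  -- 1.
  have hbB : b ∉ B := fun h => hb (hB b h)
  have ht := h.not_can_t hb hbJ
  have ht' := h'.not_can_t hb hbJ
  have hone : Can tick s b ∨ Can tick s' b → procDist tick lam (f s s') (f t t') = 1 := fun hs =>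
    procDist_eq_one hlam ((hf.can_async_iff hb hbB).2 hs)
      (fun h => ((hf.can_async_iff hb hbB).1 h).elim ht ht')
  rw [asyncBound]
  obtain ⟨he, X, rfl, rfl, rfl, rfl, rfl⟩ | ⟨rfl, -, hsb, -⟩ := h
  · obtain ⟨he', Y, rfl, rfl, rfl, rfl, rfl⟩ | ⟨rfl, -, hsb, -⟩ := h'
    · rw [if_neg (not_or.2 ⟨he, he'⟩), X.procDist_async Y hlam hf hB hτ hN hc hcY hc' hcX]
      simp only [delayBound, mul_div_cancel_left₀ _ hlam.1.ne']
      congr 1 <;> ring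
    · rw [if_pos (Or.inr rfl), hone (Or.inr hsb)]
  · rw [if_pos (Or.inl rfl), hone (Or.inl hsb)]

theorem procDist_sync (hlam : lam ∈ Set.Ioc (0 : ℝ) 1)
    (h : IsTestPair tick a b J N lam τ I e s t) (h' : IsTestPair tick a b J N lam τ' I' e' s' t')
    (ha : a ≠ tick) {B : Set A} {f : Proc A → Proc A → Proc A} (hf : ParallelOp tick B f)
    (haB : a ∈ B) : procDist tick lam (f s s') (f t t') = syncBound lam e e' := by
  have hs := h.can_s
  have hs' := h'.can_s
  -- Synchronously `a` plays this role: both s offer it, while a t equal to `nil` blocks it.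
  have hone : ¬ Can tick t a ∨ ¬ Can tick t' a → procDist tick lam (f s s') (f t t') = 1 :=
    fun ht => procDist_eq_one hlam ((hf.can_sync_iff ha haB).2 ⟨hs, hs'⟩)
      (fun h => ht.elim (fun ht => ht ((hf.can_sync_iff ha haB).1 h).1)
        (fun ht => ht ((hf.can_sync_iff ha haB).1 h).2))
  rw [syncBound]
  obtain ⟨he, X, rfl, rfl, rfl, rfl, rfl⟩ | ⟨rfl, -, -, ht⟩ := h
  · obtain ⟨he', Y, rfl, rfl, rfl, rfl, rfl⟩ | ⟨rfl, -, -, ht⟩ := h'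
    · rw [if_neg (not_or.2 ⟨he, he'⟩), X.procDist_sync Y hlam hf haB]
      simp only [delayBound, mul_div_cancel_left₀ _ hlam.1.ne']
      ring
    · rw [if_pos (Or.inr rfl), hone (Or.inr (ht a))]
  · rw [if_pos (Or.inl rfl), hone (Or.inl (ht a))]

theorem procDist_seq (hlam : lam ∈ Set.Ioc (0 : ℝ) 1)
    (h : IsTestPair tick a b J N lam true I e s t)
    (h' : IsTestPair tick a b J N lam τ' I' e' s' t')
    (hb : b ≠ tick) (hbJ : b ∉ J) (hN : HasSteps tick false {b} (PMF.pure .nil) N) {c c' : A}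
    (hc : c ∈ I) (hcY : c ∉ I') (hc' : c' ∈ I') (hcX : c' ∉ I) :
    procDist tick lam (.seq s s') (.seq t t') = seqBound lam e e' := by
  have ht := h.not_can_t hb hbJ
  have ht' := h'.not_can_t hb hbJ
  have hone : Can tick (.seq s s') b → procDist tick lam (.seq s s') (.seq t t') = 1 := fun hs =>
    procDist_eq_one hlam hs
      (fun h => (can_seq_iff.1 h).elim (fun h => ht h.2) (fun h => ht' h.2))
  rw [seqBound]
  obtain ⟨he, X, hτ, rfl, rfl, rfl, rfl⟩ | ⟨rfl, -, hsb, -⟩ := h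
  · rw [if_neg he]
    obtain ⟨-, Y, rfl, rfl, rfl, rfl, rfl⟩ | ⟨rfl, -, hsb, -⟩ := h'
    · rw [X.procDist_seq Y hlam hN hb hbJ hτ hc hcY hc' hcX]
      simp only [delayBound, mul_div_cancel_left₀ _ hlam.1.ne']
      congr 1
      ring
    -- Termination of `X.s` reveals the b of the second process. With e' = 1 the delayed bound is λ
    -- ≤ 1, so the maximum is 1.
    · have hX : Can tick X.s tick := (X.stepsS.can_iff tick).2 (Or.inl ⟨hτ, rfl⟩)
      rw [hone (can_seq_iff.2 (Or.inr ⟨hX, hsb⟩)), max_eq_right]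
      simp only [delayBound, mul_div_cancel_left₀ _ hlam.1.ne']
      linarith [hlam.2]
  · rw [if_pos rfl, hone (can_seq_iff.2 (Or.inl ⟨hb, hsb⟩))]

theorem procDist_alt (hlam : lam ∈ Set.Ioc (0 : ℝ) 1)
    (h : IsTestPair tick a b J N lam τ I e s t) (h' : IsTestPair tick a b J N lam τ' I' e' s' t')
    (hb : b ≠ tick) (hbJ : b ∉ J) {c c' : A}
    (hc : c ∈ I) (hcY : c ∉ I') (hc' : c' ∈ I') (hcX : c' ∉ I) :
    procDist tick lam (.alt s s') (.alt t t') = max e e' := by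
  have ht := h.not_can_t hb hbJ
  have ht' := h'.not_can_t hb hbJ
  have hle := h.le_one hlam
  have hle' := h'.le_one hlam
  have hone : Can tick (.alt s s') b → procDist tick lam (.alt s s') (.alt t t') = 1 := fun hs =>
    procDist_eq_one hlam hs (fun ⟨π, h⟩ => h.elim (fun h => ht ⟨π, h⟩) (fun h => ht' ⟨π, h⟩))
  obtain ⟨he, X, rfl, rfl, rfl, rfl, rfl⟩ | ⟨rfl, -, ⟨π, hπ⟩, -⟩ := h
  · obtain ⟨he', Y, rfl, rfl, rfl, rfl, rfl⟩ | ⟨rfl, -, ⟨π, hπ⟩, -⟩ := h'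
    · exact Gadget.procDist_alt hlam hc hcY hc' hcX
    · rw [hone ⟨π, Or.inr hπ⟩, max_eq_right hle]
  · rw [hone ⟨π, Or.inl hπ⟩, max_eq_left hle']

theorem _root_.can_palt_iff {p : Set.Ioo (0 : ℝ) 1} {x y : Proc A} {c : A} :
    Can tick (.palt p x y) c ↔ Can tick x c ∨ Can tick y c := by
  constructor
  · rintro ⟨π, ⟨h, -⟩ | ⟨-, h⟩ | ⟨μ, ν, h, -, -⟩⟩
    · exact Or.inl ⟨_, h⟩
    · exact Or.inr ⟨_, h⟩
    · exact Or.inl ⟨_, h⟩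
  · intro h
    by_cases hx : Can tick x c
    · by_cases hy : Can tick y c
      · obtain ⟨μ, hμ⟩ := hx
        obtain ⟨ν, hν⟩ := hy
        exact ⟨_, Or.inr (Or.inr ⟨μ, ν, hμ, hν, rfl⟩)⟩
      · obtain ⟨μ, hμ⟩ := hx
        exact ⟨μ, Or.inl ⟨hμ, hy⟩⟩
    · obtain ⟨ν, hν⟩ := h.resolve_left hx
      exact ⟨ν, Or.inr (Or.inl ⟨hx, hν⟩)⟩

theorem procDist_palt (hlam : lam ∈ Set.Ioc (0 : ℝ) 1)
    (h : IsTestPair tick a b J N lam τ I e s t) (h' : IsTestPair tick a b J N lam τ' I' e' s' t')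
    (hb : b ≠ tick) (hbJ : b ∉ J) {c c' : A}
    (hc : c ∈ I) (hcY : c ∉ I') (hc' : c' ∈ I') (hcX : c' ∉ I) (p : Set.Ioo (0 : ℝ) 1) :
    procDist tick lam (.palt p s s') (.palt p t t') = max e e' := by
  have ht := h.not_can_t hb hbJ
  have ht' := h'.not_can_t hb hbJ
  have hle := h.le_one hlam
  have hle' := h'.le_one hlam
  have hone : Can tick s b ∨ Can tick s' b →
      procDist tick lam (.palt p s s') (.palt p t t') = 1 := fun hs =>
    procDist_eq_one hlam (can_palt_iff.2 hs) (fun h => (can_palt_iff.1 h).elim ht ht')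
  obtain ⟨he, X, rfl, rfl, rfl, rfl, rfl⟩ | ⟨rfl, -, hsb, -⟩ := h
  · obtain ⟨he', Y, rfl, rfl, rfl, rfl, rfl⟩ | ⟨rfl, -, hsb, -⟩ := h'
    · exact Gadget.procDist_palt hlam p hc hcY hc' hcX
    · rw [hone (Or.inr hsb), max_eq_right hle]
  · rw [hone (Or.inl hsb), max_eq_left hle']

end IsTestPair

theorem exists_tight_processes (tick : A) (hlam : lam ∈ Set.Ioc (0 : ℝ) 1)
    (n : ℕ) (hA : ∃ F : Finset A, tick ∉ F ∧ n + 4 ≤ F.card) (ε : Fin (n + 2) → ℝ)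
    (hε : ∀ i, ε i ∈ Set.Icc (0 : ℝ) lam ∪ {1}) (B : Set A) :
    ∃ s t : Fin (n + 2) → Proc A,
      (∀ i, procDist tick lam (s i) (t i) = ε i) ∧
      (∀ (a : A) (m : ℕ) (p : Weights m) (ι : Fin m → Fin (n + 2)),
        procDist tick lam (.pre a p fun k => s (ι k)) (.pre a p fun k => t (ι k)) =
          lam * ∑ k, p.w k * ε (ι k)) ∧
      procDist tick lam (.alt (s 0) (s 1)) (.alt (t 0) (t 1)) = max (ε 0) (ε 1) ∧
      (∀ p, procDist tick lam (.palt p (s 0) (s 1)) (.palt p (t 0) (t 1)) =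
        max (ε 0) (ε 1)) ∧
      procDist tick lam (.seq (s 0) (s 1)) (.seq (t 0) (t 1)) = seqBound lam (ε 0) (ε 1) ∧
      procDist tick lam (.sync (s 0) (s 1)) (.sync (t 0) (t 1)) =
        syncBound lam (ε 0) (ε 1) ∧
      procDist tick lam (.async (s 0) (s 1)) (.async (t 0) (t 1)) =
        asyncBound lam (ε 0) (ε 1) ∧
      procDist tick lam (.csp B (s 0) (s 1)) (.csp B (t 0) (t 1)) =
        cspBound tick B lam (ε 0) (ε 1) ∧
      (∀ p, procDist tick lam (.pasync p (s 0) (s 1)) (.pasync p (t 0) (t 1)) =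
        asyncBound lam (ε 0) (ε 1)) := by
  obtain ⟨a, b, c₀, c₁, htick, hb, hbJ, hac₀, hac₁, hcc, haB⟩ := exists_actions hA B
  have ha : a ≠ tick := fun h => htick (Or.inl h.symm)
  have hN : HasSteps tick false {b} (PMF.pure .nil) (Proc.act b .nil) := by
    intro c π
    simp [step_act]
  have hNa : ¬ Can tick (Proc.act b .nil) a := by
    rw [hN.can_iff]
    have : a ≠ b := fun h => hbJ (Or.inl h.symm)
    simpa using this
  let lbl : Fin (n + 2) → A := fun i => if i = 0 then c₀ else c₁
  have hlbl : ∀ i, lbl i ∈ ({c₀, c₁} : Set A) := fun i => by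
    by_cases h : i = 0 <;> simp [lbl, h]
  -- Only index 0 may terminate and carries c₀. The remaining indices share c₁, as the binary
  -- operators use indices 0 and 1 only.
  choose s t hst using fun i => exists_isTestPair (b := b) (N := Proc.act b .nil) hlam htick
    (decide (i = 0)) (hlbl i) (hε i)
  have h0 : IsTestPair tick a b {a, c₀, c₁} (Proc.act b .nil) lam true {a, c₀} (ε 0) (s 0) (t 0) :=
    hst 0
  have h1 : IsTestPair tick a b {a, c₀, c₁} (Proc.act b .nil) lam false {a, c₁} (ε 1) (s 1)
    (t 1) := hst 1
  have m0 : c₀ ∈ ({a, c₀} : Set A) := by simp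
  have m1 : c₁ ∈ ({a, c₁} : Set A) := by simp
  have n0 : c₀ ∉ ({a, c₁} : Set A) := by simp [hac₀.symm, hcc]
  have n1 : c₁ ∉ ({a, c₀} : Set A) := by simp [hac₁.symm, hcc.symm]
  have hτ : ¬ (true = true ∧ false = true) := by simp
  have hasync : ∀ {B : Set A} {f : Proc A → Proc A → Proc A}, ParallelOp tick B f →
      (∀ c ∈ B, c = tick) →
      procDist tick lam (f (s 0) (s 1)) (f (t 0) (t 1)) = asyncBound lam (ε 0) (ε 1) :=
    fun hf hB => h0.procDist_async hlam h1 hb hbJ hNa hτ m0 n0 m1 n1 hf hB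
  refine ⟨s, t, fun i => (hst i).procDist_eq hlam, fun e m p ι => le_antisymm ?_ ?_,
    h0.procDist_alt hlam h1 hb hbJ m0 n0 m1 n1, h0.procDist_palt hlam h1 hb hbJ m0 n0 m1 n1,
    h0.procDist_seq hlam h1 hb hbJ hN m0 n0 m1 n1,
    h0.procDist_sync hlam h1 ha (parallelOp_sync tick) trivial,
    hasync (parallelOp_async tick) (fun c h => h.elim), ?_,
    fun p => hasync (parallelOp_pasync tick p) (fun c h => h.elim)⟩
  · refine (procDist_pre_le hlam e p _ _).trans_eq ?_
    simp only [(hst _).procDist_eq hlam]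
  · exact lower_bound_pre hlam (fun i j => (hst i).le_procDist hlam hb hbJ (hst j)) e p ι
  · rw [cspBound]
    split_ifs with hB
    · exact h0.procDist_sync hlam h1 ha (parallelOp_csp tick B) (haB hB)
    · refine hasync (parallelOp_csp tick B) fun c hc => ?_
      by_contra h
      exact hB ⟨c, hc, h⟩

end Main
end

theorem mainTheorem12 {A : Type*} (tick : A) (lam : ℝ) (hlam : lam ∈ Set.Ioc (0 : ℝ) 1)
    (n : ℕ) (hA : ∃ F : Finset A, tick ∉ F ∧ n + 4 ≤ F.card) :
    (∀ ε : Fin (n + 2) → ℝ, (∀ i, ε i ∈ Set.Icc (0 : ℝ) lam ∪ {1}) → ∀ B : Set A,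
      ∃ s t : Fin (n + 2) → Proc A,
        (∀ i, procDist tick lam (s i) (t i) = ε i) ∧
        (∀ (a : A) (m : ℕ) (p : Weights m) (ι : Fin m → Fin (n + 2)),
          procDist tick lam (.pre a p fun k => s (ι k)) (.pre a p fun k => t (ι k)) =
            lam * ∑ k, p.w k * ε (ι k)) ∧
        procDist tick lam (.alt (s 0) (s 1)) (.alt (t 0) (t 1)) = max (ε 0) (ε 1) ∧
        (∀ p, procDist tick lam (.palt p (s 0) (s 1)) (.palt p (t 0) (t 1)) =
          max (ε 0) (ε 1)) ∧
        procDist tick lam (.seq (s 0) (s 1)) (.seq (t 0) (t 1)) = seqBound lam (ε 0) (ε 1) ∧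
        procDist tick lam (.sync (s 0) (s 1)) (.sync (t 0) (t 1)) =
          syncBound lam (ε 0) (ε 1) ∧
        procDist tick lam (.async (s 0) (s 1)) (.async (t 0) (t 1)) =
          asyncBound lam (ε 0) (ε 1) ∧
        procDist tick lam (.csp B (s 0) (s 1)) (.csp B (t 0) (t 1)) =
          cspBound tick B lam (ε 0) (ε 1) ∧
        (∀ p, procDist tick lam (.pasync p (s 0) (s 1)) (.pasync p (t 0) (t 1)) =
          asyncBound lam (ε 0) (ε 1))) ∧
    ¬ NonExtensive tick lam .seq ∧
    ¬ NonExtensive tick lam .sync ∧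
    ¬ NonExtensive tick lam .async ∧
    (∀ B, ¬ NonExtensive tick lam (.csp B)) ∧
    (∀ p, ¬ NonExtensive tick lam (.pasync p)) := by
  have hex := exists_tight_processes tick hlam n hA
  refine ⟨hex, ?_⟩
  have hl0 := hlam.1
  have hl1 := hlam.2
  have hpos : 0 < lam * lam := mul_pos hl0 hl0
  have hpos' : 0 < lam ^ 2 * lam := mul_pos (pow_pos hl0 2) hl0
  -- With all ε equal to λ/2, each bound adds to λ/2 a positive term λⁿ·(1/2)·(λ/2).
  have hne : lam / 2 ≠ 1 := by linarith
  have hdiv : lam / 2 / lam = 1 / 2 := by field_simp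
  have hseq : lam / 2 < seqBound lam (lam / 2) (lam / 2) := by
    rw [seqBound, if_neg hne, delayBound, hdiv]
    exact lt_max_of_lt_left (by linarith)
  have hsync : lam / 2 < syncBound lam (lam / 2) (lam / 2) := by
    rw [syncBound, if_neg (not_or.2 ⟨hne, hne⟩), delayBound, hdiv]
    linarith
  have hasync : lam / 2 < asyncBound lam (lam / 2) (lam / 2) := by
    rw [asyncBound, if_neg (not_or.2 ⟨hne, hne⟩), delayBound, hdiv]
    exact lt_max_of_lt_left (by linarith)
  have hcsp : ∀ B : Set A, lam / 2 < cspBound tick B lam (lam / 2) (lam / 2) := fun B => by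
    rw [cspBound]
    split_ifs
    exacts [hsync, hasync]
  have key : ∀ B : Set A, ∃ s t : Fin (n + 2) → Proc A, _ := fun B =>
    hex (fun _ => lam / 2) (fun _ => Or.inl ⟨by linarith, by linarith⟩) B
  have contra : ∀ {f : Proc A → Proc A → Proc A} {s t : Fin (n + 2) → Proc A} {r : ℝ},
      (∀ i, procDist tick lam (s i) (t i) = lam / 2) →
      procDist tick lam (f (s 0) (s 1)) (f (t 0) (t 1)) = r → lam / 2 < r →
      ¬ NonExtensive tick lam f := by
    intro f s t r h1 h2 h3 h
    have := h (s 0) (s 1) (t 0) (t 1)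
    rw [h1, h1, h2, max_self] at this
    linarith
  -- The choice of B matters only for the CSP operator, which is treated separately for each B.
  obtain ⟨s, t, hd, -, -, -, h1, h2, h3, -, h4⟩ := key ∅
  refine ⟨contra hd h1 hseq, contra hd h2 hsync, contra hd h3 hasync, fun B => ?_,
    fun p => contra hd (h4 p) hasync⟩
  obtain ⟨s, t, hd, -, -, -, -, -, -, h, -⟩ := key B
  exact contra hd h (hcsp B)
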